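/- Let $N\ge 1$, $0<s<\min\{1,N/2\}$, $2^*_s=2N/(N-2s)$, all functions real-valued, and $\mathscr F u(\xi)=(2\pi)^{-N/2}\int_{\mathbb R^N}u(x)e^{-i\xi\cdot x}\,dx$ (extended to $L^2$). Let $V,b$ be measurable functions on $\mathbb R^N$ and write $$Q(u)=\int_{\mathbb R^N}|\xi|^{2s}|\mathscr Fu|^2\,d\xi+\int_{\mathbb R^N}V(x)u^2\,dx .$$ Assume: * $(V_1)$ there is $B\ge0$ with $V\ge -B$ a.e. in $\mathbb R^N$; * $(V_2)$ $V\in L^\infty_{loc}(\mathbb R^N)$ and $\inf\{Q(u):u\in C_0^\infty(\mathbb R^N),\ \|u\|_2=1\}>0$; * $(B_1)$ $b\in L^\infty_{loc}(\mathbb R^N)$, $b\ge1$ a.e., and for every $\alpha>1$ there are $C_0,R_0>0$ with $b(x)\le C_0\bigl(1+(V^+(x))^{1/\alpha}\bigr)$ for a.e. $|x|\ge R_0$, where $V^+=\max\{0,V\}$. Let $H^s_V(\mathbb R^N)$ be the completion of $C_0^\infty(\mathbb R^N)$ with respect to the norm $\|u\|_V=Q(u)^{1/2}$. For a measurable $K\ge0$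 and $1\le\theta<\infty$ let $L^\theta_K(\mathbb R^N)$ be the space of measurable $u$ with $\|u\|_{\theta,K}=\bigl(\int K|u|^\theta dx\bigr)^{1/\theta}<\infty$. Then: 1. The inclusion of $C_0^\infty(\mathbb R^N)$ in $L^2(\mathbb R^N)$ extends to a continuous injective linear map $H^s_V(\mathbb R^N)\to L^2(\mathbb R^N)$, so that $H^s_V(\mathbb R^N)$ is a space of functions, and for every $2\le\theta<2^*_s$ it is contained in $L^\theta_b(\mathbb R^N)$ with continuous inclusion. 2. Suppose moreover $(V_3)$: for some $2\le\theta_0<2^*_s$, $\lim_{R\to\infty}\nu_{\theta_0}(\mathbb R^N\setminus\overline{B}_R)=+\infty$, where $\nu_\theta(\Omega)=\inf Q(u)\in[-\infty,+\infty]$ over all $u\in H^s(\mathbb R^N)=\{u\in L^2(\mathbb R^N):|\cdot|^s\mathscr Fu\in L^2(\mathbb R^N)\}$ with $u=0$ a.e. outside $\Omega$ and $\|u\|_\theta=1$ (and $\inf\emptyset=+\infty$). Then for every $2\le\theta<2^*_s$ the inclusions $H^s_V(\mathbb R^N)\hookrightarrow L^\theta_b(\mathbb R^N)$ and $H^s_V(\mathbb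 R^N)\hookrightarrow L^\theta(\mathbb R^N)$ are compact. 3. Suppose $(V_3)$, let $2<p<2^*_s$, $1<q<2$, and let $a$ satisfy $(A_1)$: $a\in L^{p/(p-q)}(\mathbb R^N)$, $a\ge0$ a.e. and $a\not\equiv0$. Then the inclusion of $H^s_V(\mathbb R^N)$ in $L^q_a(\mathbb R^N)$ is continuous and compact. -/

import Mathlib

open MeasureTheory Filter Topology
open scoped ENNReal FourierTransform

noncomputable section

namespace FracSobolev

/-- The space `ℝ^N` with its Euclidean norm and Lebesgue measure. -/
abbrev Euc (N : ℕ) : Type := EuclideanSpace ℝ (Fin N)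

/-- Real-valued `L²(ℝ^N)`. -/
abbrev L2 (N : ℕ) : Type := Lp ℝ 2 (volume : Measure (Euc N))

variable {N : ℕ}

/-- A real `L²` function seen as a complex one. -/
def toComplex (u : L2 N) : Lp ℂ 2 (volume : Measure (Euc N)) :=
  Complex.ofRealCLM.compLpL 2 volume u

/-- The `L²` Fourier transform `𝓕u(ξ) = (2π)^(-N/2) ∫ u(x) e^(-i ξ·x) dx`. Mathlib's `𝓕` has the
kernel `e^(-2πi ξ·x)`, hence the rescaling. -/
def fourier (u : L2 N) : Euc N → ℂ := fun ξ ↦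
  (((2 * Real.pi) ^ (-(N : ℝ) / 2) : ℝ) : ℂ) * (𝓕 (toComplex u)) ((2 * Real.pi)⁻¹ • ξ)

/-- `C_0^∞(ℝ^N)`: the real-valued smooth functions with compact support. -/
def testFunctions (N : ℕ) : Submodule ℝ (Euc N → ℝ) where
  carrier := {φ | ContDiff ℝ (⊤ : ℕ∞) φ ∧ HasCompactSupport φ}
  add_mem' := fun h₁ h₂ ↦ ⟨h₁.1.add h₂.1, h₁.2.add h₂.2⟩
  zero_mem' := ⟨contDiff_const, HasCompactSupport.zero⟩
  smul_mem' := fun c _ h ↦ ⟨contDiff_const.smul h.1, h.2.smul_left (f := fun _ ↦ c)⟩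

theorem testFunctions_memLp (φ : testFunctions N) :
    MemLp (φ : Euc N → ℝ) 2 (volume : Measure (Euc N)) :=
  φ.2.1.continuous.memLp_of_hasCompactSupport φ.2.2

/-- The class in `L²` of a test function. -/
def testToL2 (N : ℕ) : testFunctions N →ₗ[ℝ] L2 N where
  toFun φ := (testFunctions_memLp φ).toLp φ
  map_add' _ _ := rfl
  map_smul' _ _ := rfl

/-- `(u, v)_V = ∫ |ξ|^(2s) Re (𝓕u conj(𝓕v)) dξ + ∫ V u v dx`. -/
def form (s : ℝ) (V : Euc N → ℝ) (u v : L2 N) : ℝ :=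
  (∫ ξ, ‖ξ‖ ^ (2 * s) * (fourier u ξ * (starRingEnd ℂ) (fourier v ξ)).re) + ∫ x, V x * (u x * v x)

/-- `∫ |ξ|^(2s) |𝓕u|² dξ + ∫ V u² dx`, used where both integrals converge absolutely. -/
def energy (s : ℝ) (V : Euc N → ℝ) (u : L2 N) : ℝ :=
  (∫ ξ, ‖ξ‖ ^ (2 * s) * ‖fourier u ξ‖ ^ 2) + ∫ x, V x * u x ^ 2

/-- `∫ |ξ|^(2s) |𝓕u|² dξ` in `[0, ∞]`. -/
def kinetic (s : ℝ) (u : L2 N) : ℝ≥0∞ :=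
  ∫⁻ ξ, ENNReal.ofReal (‖ξ‖ ^ (2 * s) * ‖fourier u ξ‖ ^ 2)

/-- `∫ |ξ|^(2s) |𝓕u|² dξ + ∫ V u² dx` as an extended real; the second integral is the difference of
the integrals of the positive and of the negative part of `V u²`, and the latter is finite as soon
as `V` is bounded from below. -/
def extendedEnergy (s : ℝ) (V : Euc N → ℝ) (u : L2 N) : EReal :=
  (kinetic s u : EReal) + (((∫⁻ x, ENNReal.ofReal (V x * u x ^ 2) : ℝ≥0∞) : EReal) -
    ((∫⁻ x, ENNReal.ofReal (-(V x * u x ^ 2)) : ℝ≥0∞) : EReal))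

/-- `H^s(ℝ^N)`: the `u ∈ L²` with `|·|^s 𝓕u ∈ L²`. -/
def fracSobolev (N : ℕ) (s : ℝ) : Set (L2 N) := {u | kinetic s u < ⊤}

/-- `L^∞_loc(ℝ^N)`. -/
def LocBounded (V : Euc N → ℝ) : Prop :=
  ∀ K : Set (Euc N), IsCompact K → MemLp V ⊤ (volume.restrict K)

/-- The critical exponent `2N / (N - 2s)`. -/
def critExp (N : ℕ) (s : ℝ) : ℝ := 2 * N / (N - 2 * s)

/-- `𝓜_θ(Ω)`: the `u ∈ H^s(ℝ^N)` with `u = 0` outside `Ω` and `‖u‖_θ = 1`. -/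
def admissible (s θ : ℝ) (Ω : Set (Euc N)) : Set (L2 N) :=
  {u | u ∈ fracSobolev N s ∧ (∀ᵐ x, x ∉ Ω → u x = 0) ∧
    eLpNorm u (ENNReal.ofReal θ) volume = 1}

/-- `ν_θ(Ω)`, equal to `+∞` if there is no admissible function. -/
def nu (s : ℝ) (V : Euc N → ℝ) (θ : ℝ) (Ω : Set (Euc N)) : EReal :=
  ⨅ u ∈ admissible s θ Ω, extendedEnergy s V u

/-- `(V₁)`: `V` is bounded from below. -/
def CondV1 (V : Euc N → ℝ) : Prop := ∃ B : ℝ, 0 ≤ B ∧ ∀ᵐ x, -B ≤ V x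

/-- `(V₂)`: `V ∈ L^∞_loc` and the infimum of the energy on the test functions with `‖u‖₂ = 1` is
positive (the real `sInf` of a set without lower bound is `0`, so it is not positive). -/
structure CondV2 (s : ℝ) (V : Euc N → ℝ) : Prop where
  locBounded : LocBounded V
  inf_pos : 0 < sInf {t : ℝ | ∃ φ : testFunctions N, ‖testToL2 N φ‖ = 1 ∧
    t = energy s V (testToL2 N φ)}

/-- `(V₃)`: for some `θ₀ ∈ [2, 2*_s)`, `ν_θ₀` of the exterior of the ball of radius `R` tends to
`+∞`. -/
def CondV3 (s : ℝ) (V : Euc N → ℝ) : Prop :=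
  ∃ θ₀ : ℝ, 2 ≤ θ₀ ∧ θ₀ < critExp N s ∧
    Tendsto (fun R : ℝ ↦ nu s V θ₀ (Metric.closedBall (0 : Euc N) R)ᶜ) atTop (𝓝 ⊤)

/-- `(B₁)`: `b ∈ L^∞_loc`, `b ≥ 1` and, for every `α > 1`, `b ≤ C₀ (1 + (V⁺)^(1/α))` outside a ball.
The constants may depend on `α`. -/
structure CondB1 (V b : Euc N → ℝ) : Prop where
  locBounded : LocBounded b
  one_le : ∀ᵐ x, 1 ≤ b x
  growth : ∀ α : ℝ, 1 < α → ∃ C₀ R₀ : ℝ, 0 < C₀ ∧ 0 < R₀ ∧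
    ∀ᵐ x, R₀ ≤ ‖x‖ → b x ≤ C₀ * (1 + (max 0 (V x)) ^ (1 / α))

/-- `(A₁)`: `a ∈ L^(p/(p-q))`, `a ≥ 0` and `a` is not zero. -/
structure CondA1 (p q : ℝ) (a : Euc N → ℝ) : Prop where
  memLp : MemLp a (ENNReal.ofReal (p / (p - q))) volume
  nonneg : ∀ᵐ x, 0 ≤ a x
  ne_zero : ¬ a =ᵐ[volume] 0

section Completion

/-! The norm `‖·‖_V` on the test functions. -/

theorem testToL2_coe (φ : testFunctions N) : testToL2 N φ =ᵐ[volume] (φ : Euc N → ℝ) :=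
  (testFunctions_memLp φ).coeFn_toLp

theorem toComplex_add (u v : L2 N) : toComplex (u + v) = toComplex u + toComplex v :=
  map_add _ u v

theorem toComplex_smul (c : ℝ) (u : L2 N) : toComplex (c • u) = (c : ℂ) • toComplex u := by
  have h : toComplex (c • u) = c • toComplex u := map_smul (Complex.ofRealCLM.compLpL 2 volume) c u
  rw [h]
  ext1
  filter_upwards [Lp.coeFn_smul c (toComplex u), Lp.coeFn_smul (c : ℂ) (toComplex u)] with x h1 h2
  rw [h1, h2]; simp

theorem ae_smul_comp {p : Euc N → Prop} (h : ∀ᵐ x, p x) :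
    ∀ᵐ x : Euc N, p ((2 * Real.pi)⁻¹ • x) := by
  have hc : (2 * Real.pi)⁻¹ ≠ 0 := by positivity
  have : Measure.QuasiMeasurePreserving (fun x : Euc N ↦ (2 * Real.pi)⁻¹ • x) volume volume := by
    refine ⟨by fun_prop, ?_⟩
    rw [Measure.map_addHaar_smul volume hc]
    exact Measure.smul_absolutelyContinuous
  exact this.ae h

theorem fourier_add (u v : L2 N) :
    ∀ᵐ ξ, fourier (u + v) ξ = fourier u ξ + fourier v ξ := by
  have h : 𝓕 (toComplex (u + v)) = 𝓕 (toComplex u) + 𝓕 (toComplex v) := by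
    rw [toComplex_add, FourierTransform.fourier_add]
  filter_upwards [ae_smul_comp (Lp.coeFn_add (𝓕 (toComplex u)) (𝓕 (toComplex v)))] with ξ hξ
  simp only [fourier, h, hξ, Pi.add_apply]
  ring

theorem fourier_smul (c : ℝ) (u : L2 N) :
    ∀ᵐ ξ, fourier (c • u) ξ = c * fourier u ξ := by
  have h : 𝓕 (toComplex (c • u)) = (c : ℂ) • 𝓕 (toComplex u) := by
    rw [toComplex_smul, FourierTransform.fourier_smul]
  filter_upwards [ae_smul_comp (Lp.coeFn_smul (c : ℂ) (𝓕 (toComplex u)))] with ξ hξ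
  simp only [fourier, h, hξ, Pi.smul_apply, smul_eq_mul]
  ring

/-- A test function as a complex Schwartz function. -/
def toSchwartz (φ : testFunctions N) : SchwartzMap (Euc N) ℂ :=
  (φ.2.2.comp_left (g := fun t : ℝ ↦ (t : ℂ)) Complex.ofReal_zero).toSchwartzMap
    (Complex.ofRealCLM.contDiff.comp φ.2.1)

theorem toComplex_test (φ : testFunctions N) : toComplex (testToL2 N φ) = (toSchwartz φ).toLp 2 := by
  ext1
  filter_upwards [Complex.ofRealCLM.coeFn_compLpL (p := 2) (testToL2 N φ),
    (toSchwartz φ).coeFn_toLp 2, testToL2_coe φ] with x h1 h2 h3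
  rw [toComplex, h1, h2, h3]
  rfl

theorem fourier_test (φ : testFunctions N) :
    ∀ᵐ ξ, fourier (testToL2 N φ) ξ = (((2 * Real.pi) ^ (-(N : ℝ) / 2) : ℝ) : ℂ) *
      (𝓕 (toSchwartz φ)) ((2 * Real.pi)⁻¹ • ξ) := by
  filter_upwards [ae_smul_comp ((𝓕 (toSchwartz φ)).coeFn_toLp 2 volume)] with ξ hξ
  rw [fourier, toComplex_test, SchwartzMap.toLp_fourier_eq, hξ]

theorem memLp_weighted_schwartz {s : ℝ} (hs : 0 ≤ s) (f : SchwartzMap (Euc N) ℂ) :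
    MemLp (fun ξ : Euc N ↦ ((‖ξ‖ ^ s : ℝ) : ℂ) * f ξ) 2 volume := by
  have hm : Continuous (fun ξ : Euc N ↦ ((‖ξ‖ ^ s : ℝ) : ℂ) * f ξ) := by
    have := f.continuous
    have h2 : Continuous (fun ξ : Euc N ↦ ‖ξ‖ ^ s) :=
      continuous_norm.rpow_const fun _ ↦ Or.inr hs
    fun_prop
  obtain ⟨k, hk⟩ := exists_nat_ge s
  obtain ⟨C, hC⟩ := f.decay k 0
  obtain ⟨D, hD⟩ := f.decay 0 0
  have hb : ∀ ξ : Euc N, ‖((‖ξ‖ ^ s : ℝ) : ℂ) * f ξ‖ ≤ D + C := by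
    intro ξ
    have h1 := hC.2 ξ
    have h2 := hD.2 ξ
    simp only [norm_iteratedFDeriv_zero, pow_zero, one_mul] at h1 h2
    have h3 : ‖ξ‖ ^ s ≤ 1 + ‖ξ‖ ^ k := by
      rcases le_total ‖ξ‖ 1 with h | h
      · have := Real.rpow_le_one (norm_nonneg ξ) h hs
        have : 0 ≤ ‖ξ‖ ^ k := by positivity
        linarith
      · have := Real.rpow_le_rpow_of_exponent_le h hk
        rw [Real.rpow_natCast] at this
        linarith
    rw [norm_mul, Complex.norm_real, Real.norm_of_nonneg (by positivity)]
    nlinarith [norm_nonneg (f ξ)]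
  have hi : Integrable (fun ξ : Euc N ↦ ((‖ξ‖ ^ s : ℝ) : ℂ) * f ξ) := by
    have h0 : Integrable (fun ξ : Euc N ↦ ‖f ξ‖ + ‖ξ‖ ^ k * ‖f ξ‖) :=
      f.integrable.norm.add (f.integrable_pow_mul volume k)
    refine h0.mono' hm.aestronglyMeasurable (ae_of_all _ fun ξ ↦ ?_)
    have h3 : ‖ξ‖ ^ s ≤ 1 + ‖ξ‖ ^ k := by
      rcases le_total ‖ξ‖ 1 with h | h
      · have := Real.rpow_le_one (norm_nonneg ξ) h hs
        have : 0 ≤ ‖ξ‖ ^ k := by positivity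
        linarith
      · have := Real.rpow_le_rpow_of_exponent_le h hk
        rw [Real.rpow_natCast] at this
        linarith
    rw [norm_mul, Complex.norm_real, Real.norm_of_nonneg (by positivity)]
    nlinarith [norm_nonneg (f ξ)]
  rw [memLp_two_iff_integrable_sq_norm hm.aestronglyMeasurable]
  refine (hi.norm.const_mul (D + C)).mono' (by fun_prop) (ae_of_all _ fun ξ ↦ ?_)
  rw [Real.norm_of_nonneg (by positivity), sq]
  exact mul_le_mul_of_nonneg_right (hb ξ) (norm_nonneg _)

theorem memLp_weighted_fourier {s : ℝ} (hs : 0 ≤ s) (φ : testFunctions N) :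
    MemLp (fun ξ : Euc N ↦ ((‖ξ‖ ^ s : ℝ) : ℂ) * fourier (testToL2 N φ) ξ) 2 volume := by
  have hc : (2 * Real.pi)⁻¹ ≠ 0 := by positivity
  have h1 := memLp_weighted_schwartz hs (𝓕 (toSchwartz φ))
  have h2 : MemLp (fun ξ : Euc N ↦ ((‖(2 * Real.pi)⁻¹ • ξ‖ ^ s : ℝ) : ℂ) *
      (𝓕 (toSchwartz φ)) ((2 * Real.pi)⁻¹ • ξ)) 2 volume := by
    rw [memLp_two_iff_integrable_sq_norm h1.1] at h1
    have h3 := h1.comp_smul hc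
    refine (memLp_two_iff_integrable_sq_norm ?_).2 h3
    have h2' : Continuous (fun ξ : Euc N ↦ ‖(2 * Real.pi)⁻¹ • ξ‖ ^ s) :=
      (by fun_prop : Continuous fun ξ : Euc N ↦ ‖(2 * Real.pi)⁻¹ • ξ‖).rpow_const fun _ ↦ Or.inr hs
    have h4 := (𝓕 (toSchwartz φ)).continuous
    exact (by fun_prop : Continuous _).aestronglyMeasurable
  have h5 := h2.const_mul ((((2 * Real.pi) ^ s : ℝ) : ℂ) *
    (((2 * Real.pi) ^ (-(N : ℝ) / 2) : ℝ) : ℂ))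
  refine h5.ae_eq ?_
  filter_upwards [fourier_test φ] with ξ hξ
  have h6 : ‖(2 * Real.pi)⁻¹ • ξ‖ ^ s = ((2 * Real.pi) ^ s)⁻¹ * ‖ξ‖ ^ s := by
    rw [norm_smul, Real.norm_of_nonneg (by positivity),
      Real.mul_rpow (by positivity) (norm_nonneg _), Real.inv_rpow (by positivity)]
  have h7 : (((2 * Real.pi) ^ s : ℝ) : ℂ) ≠ 0 := by
    exact_mod_cast (by positivity : (2 * Real.pi) ^ s ≠ 0)
  rw [hξ, h6, Complex.ofReal_mul, Complex.ofReal_inv]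
  field_simp

theorem integrable_kinetic {s : ℝ} (hs : 0 ≤ s) (φ ψ : testFunctions N) :
    Integrable (fun ξ : Euc N ↦ ‖ξ‖ ^ (2 * s) *
      (fourier (testToL2 N φ) ξ * (starRingEnd ℂ) (fourier (testToL2 N ψ) ξ)).re) := by
  have h := ((memLp_weighted_fourier hs φ).integrable_mul (memLp_weighted_fourier hs ψ).star).re
  refine h.congr (ae_of_all _ fun ξ ↦ ?_)
  have h2 : ‖ξ‖ ^ (2 * s) = ‖ξ‖ ^ s * ‖ξ‖ ^ s := by
    rw [two_mul, Real.rpow_add_of_nonneg (norm_nonneg _) hs hs]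
  simp only [Pi.mul_apply, Pi.star_apply, star_mul', RCLike.star_def, Complex.conj_ofReal, h2,
    RCLike.re_to_complex]
  rw [mul_mul_mul_comm, ← Complex.ofReal_mul, Complex.re_ofReal_mul]

theorem integrable_potential {V : Euc N → ℝ} (hV : LocBounded V) (φ ψ : testFunctions N) :
    Integrable (fun x : Euc N ↦ V x * (testToL2 N φ x * testToL2 N ψ x)) := by
  have hK : IsCompact (tsupport (φ : Euc N → ℝ)) := φ.2.2
  have : IsFiniteMeasure (volume.restrict (tsupport (φ : Euc N → ℝ))) :=
    isFiniteMeasure_restrict.2 hK.measure_lt_top.ne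
  have h1 : Integrable V (volume.restrict (tsupport (φ : Euc N → ℝ))) :=
    (hV _ hK).integrable le_top
  have hc : Continuous (fun x ↦ (φ : Euc N → ℝ) x * (ψ : Euc N → ℝ) x) :=
    φ.2.1.continuous.mul ψ.2.1.continuous
  have hcs : HasCompactSupport (fun x ↦ (φ : Euc N → ℝ) x * (ψ : Euc N → ℝ) x) :=
    φ.2.2.mul_right
  obtain ⟨C, hC⟩ := hcs.exists_bound_of_continuous hc
  have h2 : IntegrableOn (fun x ↦ V x * ((φ : Euc N → ℝ) x * (ψ : Euc N → ℝ) x))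
      (tsupport (φ : Euc N → ℝ)) :=
    h1.mul_bdd hc.aestronglyMeasurable (ae_of_all _ hC)
  rw [integrableOn_iff_integrable_of_support_subset] at h2
  · refine h2.congr ?_
    filter_upwards [testToL2_coe φ, testToL2_coe ψ] with x hx hy
    rw [hx, hy]
  · intro x hx
    refine subset_tsupport _ ?_
    simp only [Function.mem_support] at hx ⊢
    exact fun h ↦ hx (by simp [h])

theorem form_self (s : ℝ) (V : Euc N → ℝ) (u : L2 N) : form s V u u = energy s V u := by
  simp only [form, energy, Complex.mul_conj, Complex.ofReal_re, Complex.normSq_eq_norm_sq, sq]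

theorem form_comm (s : ℝ) (V : Euc N → ℝ) (u v : L2 N) : form s V u v = form s V v u := by
  unfold form
  congr 1
  · refine integral_congr_ae (ae_of_all _ fun ξ ↦ ?_)
    simp only [Complex.mul_re, Complex.conj_re, Complex.conj_im]
    ring
  · refine integral_congr_ae (ae_of_all _ fun x ↦ ?_)
    simp only [mul_comm (u x)]

theorem form_add {s : ℝ} (hs : 0 ≤ s) {V : Euc N → ℝ} (hV : LocBounded V)
    (φ₁ φ₂ ψ : testFunctions N) :
    form s V (testToL2 N (φ₁ + φ₂)) (testToL2 N ψ) =
      form s V (testToL2 N φ₁) (testToL2 N ψ) + form s V (testToL2 N φ₂) (testToL2 N ψ) := by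
  unfold form
  rw [add_add_add_comm, ← integral_add (integrable_kinetic hs φ₁ ψ) (integrable_kinetic hs φ₂ ψ),
    ← integral_add (integrable_potential hV φ₁ ψ) (integrable_potential hV φ₂ ψ), map_add]
  congr 1
  · refine integral_congr_ae ?_
    filter_upwards [fourier_add (testToL2 N φ₁) (testToL2 N φ₂)] with ξ hξ
    rw [hξ, add_mul, Complex.add_re, mul_add]
  · refine integral_congr_ae ?_
    filter_upwards [Lp.coeFn_add (testToL2 N φ₁) (testToL2 N φ₂)] with x hx
    rw [hx, Pi.add_apply]
    ring

theorem form_smul (s : ℝ) (V : Euc N → ℝ) (c : ℝ) (φ ψ : testFunctions N) :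
    form s V (testToL2 N (c • φ)) (testToL2 N ψ) =
      c * form s V (testToL2 N φ) (testToL2 N ψ) := by
  unfold form
  rw [mul_add, ← integral_const_mul, ← integral_const_mul, map_smul]
  congr 1
  · refine integral_congr_ae ?_
    filter_upwards [fourier_smul c (testToL2 N φ)] with ξ hξ
    rw [hξ, mul_assoc, Complex.re_ofReal_mul]
    ring
  · refine integral_congr_ae ?_
    filter_upwards [Lp.coeFn_smul c (testToL2 N φ)] with x hx
    rw [hx, Pi.smul_apply, smul_eq_mul]
    ring

/-- `(V₂)` bounds the `L²` norm of test functions by the energy. -/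
theorem CondV2.coercive {s : ℝ} {V : Euc N → ℝ} (hV : CondV2 s V) :
    ∃ κ : ℝ, 0 < κ ∧ ∀ φ : testFunctions N,
      κ * ‖testToL2 N φ‖ ^ 2 ≤ form s V (testToL2 N φ) (testToL2 N φ) := by
  refine ⟨_, hV.inf_pos, fun φ ↦ ?_⟩
  have hbdd : BddBelow {t : ℝ | ∃ φ : testFunctions N, ‖testToL2 N φ‖ = 1 ∧
      t = energy s V (testToL2 N φ)} := by
    by_contra h
    have := hV.inf_pos
    rw [Real.sInf_of_not_bddBelow h] at this
    exact lt_irrefl _ this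
  rcases eq_or_ne ‖testToL2 N φ‖ 0 with h0 | h0
  · have h1 : testToL2 N φ = testToL2 N ((0 : ℝ) • φ) := by
      rw [map_smul, zero_smul]; exact norm_eq_zero.1 h0
    have h2 : form s V (testToL2 N φ) (testToL2 N φ) = 0 := by
      calc form s V (testToL2 N φ) (testToL2 N φ)
          = form s V (testToL2 N ((0 : ℝ) • φ)) (testToL2 N φ) := by rw [← h1]
        _ = 0 := by rw [form_smul, zero_mul]
    rw [h0, h2]; simp
  · have h1 := csInf_le hbdd ⟨‖testToL2 N φ‖⁻¹ • φ, by
      rw [map_smul, norm_smul, norm_inv, norm_norm, inv_mul_cancel₀ h0], rfl⟩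
    rw [← form_self, form_smul, form_comm, form_smul, ← mul_assoc] at h1
    have h2 : 0 < ‖testToL2 N φ‖ := lt_of_le_of_ne (norm_nonneg _) h0.symm
    calc _ ≤ (‖testToL2 N φ‖⁻¹ * ‖testToL2 N φ‖⁻¹ * form s V (testToL2 N φ) (testToL2 N φ)) *
          ‖testToL2 N φ‖ ^ 2 := mul_le_mul_of_nonneg_right h1 (by positivity)
      _ = _ := by field_simp

variable {s : ℝ} {V : Euc N → ℝ}

/-- `C_0^∞(ℝ^N)` endowed with the inner product `(·, ·)_V`, a type synonym. -/
def TestSpace (_hs : 0 < s) (_hV : CondV2 s V) : Type := testFunctions N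

variable (hs : 0 < s) (hV : CondV2 s V)

instance : AddCommGroup (TestSpace hs hV) := inferInstanceAs (AddCommGroup (testFunctions N))

instance : Module ℝ (TestSpace hs hV) := inferInstanceAs (Module ℝ (testFunctions N))

/-- The underlying test function. -/
def TestSpace.val (φ : TestSpace hs hV) : testFunctions N := φ

/-- The inner product `(·, ·)_V`. -/
@[reducible] def innerCore : InnerProductSpace.Core ℝ (TestSpace hs hV) where
  inner φ ψ := form s V (testToL2 N φ.val) (testToL2 N ψ.val)
  conj_inner_symm φ ψ := form_comm s V _ _
  re_inner_nonneg φ := by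
    obtain ⟨κ, hκ, h⟩ := hV.coercive
    exact le_trans (by positivity) (h φ.val)
  add_left φ₁ φ₂ ψ := form_add hs.le hV.locBounded φ₁.val φ₂.val ψ.val
  smul_left φ ψ c := form_smul s V c φ.val ψ.val
  definite φ h0 := by
    obtain ⟨κ, hκ, h⟩ := hV.coercive
    have h1 := h φ.val
    have h2 : testToL2 N φ.val = 0 := by
      rw [← norm_eq_zero, ← sq_eq_zero_iff]
      refine le_antisymm ?_ (by positivity)
      have h3 : κ * ‖testToL2 N φ.val‖ ^ 2 ≤ 0 := le_of_le_of_eq h1 h0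
      nlinarith
    have h3 : ((φ.val : testFunctions N) : Euc N → ℝ) =ᵐ[volume] fun _ ↦ 0 := by
      have h4 := testToL2_coe φ.val
      rw [h2] at h4
      exact h4.symm.trans (Lp.coeFn_zero ℝ 2 volume)
    have h5 := (Continuous.ae_eq_iff_eq volume φ.val.2.1.continuous continuous_const).1 h3
    exact Subtype.ext h5

instance : NormedAddCommGroup (TestSpace hs hV) :=
  (innerCore hs hV).toNormedAddCommGroup

instance : InnerProductSpace ℝ (TestSpace hs hV) :=
  InnerProductSpace.ofCore (innerCore hs hV).toCore

theorem TestSpace.norm_sq (φ : TestSpace hs hV) :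
    ‖φ‖ ^ 2 = energy s V (testToL2 N φ.val) := by
  rw [← form_self]
  exact (real_inner_self_eq_norm_sq φ).symm

/-- The inclusion of `(C_0^∞, ‖·‖_V)` into `L²`. -/
def TestSpace.toL2 : TestSpace hs hV →L[ℝ] L2 N :=
  LinearMap.mkContinuousOfExistsBound
    { toFun := fun φ ↦ testToL2 N φ.val
      map_add' := fun φ ψ ↦ map_add (testToL2 N) φ.val ψ.val
      map_smul' := fun c φ ↦ map_smul (testToL2 N) c φ.val } <| by
    obtain ⟨κ, hκ, h⟩ := hV.coercive
    refine ⟨(Real.sqrt κ)⁻¹, fun φ ↦ ?_⟩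
    have h1 := h φ.val
    rw [form_self, ← TestSpace.norm_sq hs hV φ] at h1
    have h2 : Real.sqrt κ * ‖testToL2 N φ.val‖ ≤ ‖φ‖ := by
      refine abs_le_of_sq_le_sq' ?_ (norm_nonneg _) |>.2
      rw [mul_pow, Real.sq_sqrt hκ.le]
      exact h1
    rw [inv_mul_eq_div, le_div_iff₀ (Real.sqrt_pos.2 hκ), mul_comm]
    exact h2

/-- `H^s_V(ℝ^N)`: the completion of `C_0^∞(ℝ^N)` with respect to `‖·‖_V`, a Hilbert space. -/
abbrev HsV : Type := UniformSpace.Completion (TestSpace hs hV)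

/-- The functions represented by the elements of `H^s_V(ℝ^N)`: the unique continuous extension to
the completion of the inclusion of the test functions into `L²`. -/
def HsV.toL2 : HsV hs hV →L[ℝ] L2 N :=
  (TestSpace.toL2 hs hV).extend
    (UniformSpace.Completion.toComplL : TestSpace hs hV →L[ℝ] HsV hs hV)

theorem HsV.toL2_coe (φ : TestSpace hs hV) :
    HsV.toL2 hs hV (φ : HsV hs hV) = testToL2 N φ.val :=
  ContinuousLinearMap.extend_eq (TestSpace.toL2 hs hV)
    (e := (UniformSpace.Completion.toComplL : TestSpace hs hV →L[ℝ] HsV hs hV))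
    UniformSpace.Completion.denseRange_coe
    (UniformSpace.Completion.isUniformInducing_coe _) φ

/-- The measure `K(x) dx`; its `L^θ` space is the weighted space `L^θ_K(ℝ^N)`. -/
def weighted (K : Euc N → ℝ) : Measure (Euc N) :=
  volume.withDensity fun x ↦ ENNReal.ofReal (K x)

/-- Every function in `H^s_V(ℝ^N)` lies in `L^θ(μ)` and the inclusion is bounded. -/
def EmbedsContinuously (μ : Measure (Euc N)) (θ : ℝ) : Prop :=
  ∃ _ : Fact (1 ≤ ENNReal.ofReal θ), ∃ T : HsV hs hV →L[ℝ] Lp ℝ (ENNReal.ofReal θ) μ,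
    ∀ u, T u =ᵐ[μ] HsV.toL2 hs hV u

/-- Every function in `H^s_V(ℝ^N)` lies in `L^θ(μ)` and the inclusion is bounded and compact. -/
def EmbedsCompactly (μ : Measure (Euc N)) (θ : ℝ) : Prop :=
  ∃ _ : Fact (1 ≤ ENNReal.ofReal θ), ∃ T : HsV hs hV →L[ℝ] Lp ℝ (ENNReal.ofReal θ) μ,
    (∀ u, T u =ᵐ[μ] HsV.toL2 hs hV u) ∧ IsCompactOperator T

end Completion

end FracSobolev

end

open MeasureTheory Filter Topology
open scoped ENNReal FourierTransform

noncomputable section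

namespace FracSobolev

variable {N : ℕ}

/-! All estimates are proved for test functions and then pass to the completion by density. Since
(V₂) bounds the `L²` norm by the energy norm and (V₁) bounds the negative part of `V`, the energy
norm dominates separately the kinetic energy, `∫ V⁺u²` and `∫ u²` (`CondV2.exists_bound`).

Injectivity is closability of the form. For a fixed test function `ψ` the functional `(ψ, ·)_V` is
`L²`-bounded, because `|ξ|^(2s) 𝓕ψ` and `Vψ` are square integrable. A limit `u` that vanishes in
`L²` is therefore orthogonal to every test function, hence zero.

The embeddings rest on one property, `Controlled`: on bounded sets of test functions `∫ |u|^θ dμ` is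
at most a modulus of `‖u‖₂`. For Lebesgue measure it follows from the subcritical Sobolev inequality
by interpolation with `L²`; the Sobolev inequality comes from a weak-type bound at the critical
exponent (`volume_lt_norm_le`), obtained by cutting frequencies at a height-dependent level. For the
weight `b` one uses `b ≤ C (1 + (V⁺)^t)` with small `t` and Hölder between `∫ V⁺u²` and a
subcritical power; for `a`, Hölder alone. By homogeneity, `Controlled` gives continuity, and it
reduces compactness to total boundedness of the unit ball in `L²`.

Total boundedness has a local and a global half. Locally, the low frequency part is uniformly
bounded and Lipschitz, so finitely many point values determine it up to a small error, while the
high frequency part is small by the kinetic energy (`totallyBounded_of_tail`). Globally, (V₃) yields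
uniformly small tails (`exists_tail`): `u` is multiplied by unit-size windows `χ(· - y)`, the lower
bound of `ν` is applied to each window far out, and one integrates over `y`. Plancherel in `y` shows
that the windowed kinetic energies integrate to at most a multiple of the full norm, so no pointwise
formula for the fractional Laplacian is needed. On a unit ball `L^θ₀` dominates `L²`, which is why
any `θ₀ ≥ 2` serves. -/

/-! ### Fourier multipliers and splitting into low and high frequencies -/

/-- `∫ |ξ|^(2s) |𝓕g|² dξ` for a Schwartz function and the unnormalised Fourier transform. -/
def schwartzKinetic (s : ℝ) (g : SchwartzMap (Euc N) ℂ) : ℝ≥0∞ :=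
  ∫⁻ ξ, ENNReal.ofReal (‖ξ‖ ^ (2 * s)) * ‖𝓕 g ξ‖ₑ ^ 2

theorem measurable_norm_rpow (t : ℝ) :
    Measurable fun ξ : Euc N ↦ ENNReal.ofReal (‖ξ‖ ^ t) := by
  fun_prop

theorem lintegral_enorm_sq_fourier (g : SchwartzMap (Euc N) ℂ) :
    ∫⁻ ξ, ‖𝓕 g ξ‖ₑ ^ 2 = ∫⁻ x, ‖g x‖ₑ ^ 2 := by
  have key : ∀ f : SchwartzMap (Euc N) ℂ,
      ∫⁻ ξ, ‖f ξ‖ₑ ^ 2 = ENNReal.ofReal (∫ ξ, ‖f ξ‖ ^ 2) := by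
    intro f
    have hi : Integrable (fun ξ ↦ ‖f ξ‖ ^ 2) volume :=
      (memLp_two_iff_integrable_sq_norm f.continuous.aestronglyMeasurable).1 (f.memLp 2)
    rw [ofReal_integral_eq_lintegral_ofReal hi (ae_of_all _ fun _ ↦ by positivity)]
    simp only [ENNReal.ofReal_pow (norm_nonneg _), ofReal_norm]
  rw [key, key, SchwartzMap.integral_norm_sq_fourier]

/-- The Fourier multiplier with a Schwartz symbol. -/
def multiplier (m g : SchwartzMap (Euc N) ℂ) : SchwartzMap (Euc N) ℂ :=
  𝓕⁻ (SchwartzMap.pairing (ContinuousLinearMap.mul ℂ ℂ) m (𝓕 g))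

theorem fourier_multiplier (m g : SchwartzMap (Euc N) ℂ) (ξ : Euc N) :
    𝓕 (multiplier m g) ξ = m ξ * 𝓕 g ξ := by
  rw [multiplier, FourierTransform.fourier_fourierInv_eq, SchwartzMap.pairing_apply_apply]
  rfl

theorem multiplier_apply (m g : SchwartzMap (Euc N) ℂ) (x : Euc N) :
    multiplier m g x = ∫ ξ, Real.fourierChar (inner ℝ ξ x) • (m ξ * 𝓕 g ξ) := by
  rw [multiplier, SchwartzMap.fourierInv_coe, Real.fourierInv_eq]
  rfl

theorem enorm_multiplier_le (m g : SchwartzMap (Euc N) ℂ) (x : Euc N) :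
    ‖multiplier m g x‖ₑ ≤ ∫⁻ ξ, ‖m ξ‖ₑ * ‖𝓕 g ξ‖ₑ := by
  rw [multiplier_apply]
  refine (enorm_integral_le_lintegral_enorm _).trans (lintegral_mono fun ξ ↦ ?_)
  rw [Circle.smul_def, enorm_smul, enorm_mul,
    ← ofReal_norm ((Real.fourierChar (inner ℝ ξ x) : Circle) : ℂ), Circle.norm_coe]
  simp

/-- A smooth low frequency cutoff: `1` on the ball of radius `A`, supported in the ball of radius
`2 A`. -/
theorem exists_cutoff {A : ℝ} (hA : 0 < A) : ∃ m : SchwartzMap (Euc N) ℂ,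
    (∀ ξ, ‖m ξ‖ ≤ 1) ∧ (∀ ξ, ‖1 - m ξ‖ ≤ 1) ∧ (∀ ξ, ‖ξ‖ ≤ A → m ξ = 1) ∧
      ∀ ξ, 2 * A ≤ ‖ξ‖ → m ξ = 0 := by
  let f : ContDiffBump (0 : Euc N) := ⟨A, 2 * A, hA, by linarith⟩
  have hf : ContDiff ℝ ((⊤ : ℕ∞) : WithTop ℕ∞) fun x : Euc N ↦ ((f x : ℝ) : ℂ) :=
    Complex.ofRealCLM.contDiff.comp f.contDiff
  refine ⟨(f.hasCompactSupport.comp_left (g := fun t : ℝ ↦ (t : ℂ))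
    Complex.ofReal_zero).toSchwartzMap hf, fun ξ ↦ ?_, fun ξ ↦ ?_, fun ξ h ↦ ?_, fun ξ h ↦ ?_⟩
  · change ‖((f ξ : ℝ) : ℂ)‖ ≤ 1
    rw [Complex.norm_real, Real.norm_of_nonneg f.nonneg]
    exact f.le_one
  · change ‖1 - ((f ξ : ℝ) : ℂ)‖ ≤ 1
    rw [← Complex.ofReal_one, ← Complex.ofReal_sub, Complex.norm_real,
      Real.norm_of_nonneg (sub_nonneg.2 f.le_one)]
    linarith [f.nonneg (x := ξ)]
  · change ((f ξ : ℝ) : ℂ) = 1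
    rw [f.one_of_mem_closedBall (by simpa using h)]
    simp
  · change ((f ξ : ℝ) : ℂ) = 0
    rw [f.zero_of_le_dist (by simpa using h)]
    simp

/-- By Plancherel only the symbol `1 - m` matters: it vanishes for `‖ξ‖ ≤ A`, and beyond that `1 ≤
A^(-2s) ‖ξ‖^(2s)`. -/
theorem lintegral_enorm_sq_sub_multiplier_le {s A : ℝ} (hs : 0 < s) (hA : 0 < A)
    {m : SchwartzMap (Euc N) ℂ} (hm : ∀ ξ, ‖1 - m ξ‖ ≤ 1) (hm1 : ∀ ξ, ‖ξ‖ ≤ A → m ξ = 1)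
    (g : SchwartzMap (Euc N) ℂ) :
    ∫⁻ x, ‖g x - multiplier m g x‖ₑ ^ 2 ≤ ENNReal.ofReal (A ^ (-(2 * s))) * schwartzKinetic s g := by
  have h1 : ∫⁻ x, ‖g x - multiplier m g x‖ₑ ^ 2 = ∫⁻ ξ, ‖(1 - m ξ) * 𝓕 g ξ‖ₑ ^ 2 := by
    have := lintegral_enorm_sq_fourier (g - multiplier m g)
    have h2 : 𝓕 (g - multiplier m g) = 𝓕 g - 𝓕 (multiplier m g) :=
      map_sub (FourierTransform.fourierCLM ℂ (SchwartzMap (Euc N) ℂ)) g (multiplier m g)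
    rw [h2] at this
    simp only [sub_apply, fourier_multiplier] at this
    rw [← this]
    simp only [sub_mul, one_mul]
  rw [h1, schwartzKinetic, ← lintegral_const_mul' _ _ ENNReal.ofReal_ne_top]
  refine lintegral_mono fun ξ ↦ ?_
  rcases le_or_gt ‖ξ‖ A with h | h
  · simp [hm1 ξ h]
  · have h2 : ‖(1 - m ξ)‖ₑ ≤ 1 := by
      rw [← ofReal_norm]; exact ENNReal.ofReal_le_one.2 (hm ξ)
    have h3 : 1 ≤ ENNReal.ofReal (A ^ (-(2 * s))) * ENNReal.ofReal (‖ξ‖ ^ (2 * s)) := by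
      rw [← ENNReal.ofReal_mul (by positivity), ENNReal.one_le_ofReal, Real.rpow_neg hA.le,
        inv_mul_eq_div, one_le_div (by positivity)]
      exact Real.rpow_le_rpow hA.le h.le (by positivity)
    rw [enorm_mul, mul_pow, ← mul_assoc]
    gcongr
    exact (pow_le_one' h2 2).trans h3

/-- Scaling `ξ ↦ rξ`. It makes explicit how the low frequency bound depends on the cutoff, which
fixes the critical exponent later. -/
theorem lintegral_ball_norm_rpow {r t : ℝ} (hr : 0 < r) :
    ∫⁻ ξ in Metric.ball (0 : Euc N) r, ENNReal.ofReal (‖ξ‖ ^ t) =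
      ENNReal.ofReal (r ^ ((N : ℝ) + t)) *
        ∫⁻ ξ in Metric.ball (0 : Euc N) 1, ENNReal.ofReal (‖ξ‖ ^ t) := by
  rw [← lintegral_indicator Metric.isOpen_ball.measurableSet,
    ← lintegral_indicator Metric.isOpen_ball.measurableSet]
  set f := (Metric.ball (0 : Euc N) r).indicator fun ξ ↦ ENNReal.ofReal (‖ξ‖ ^ t)
  have hf : Measurable f := (measurable_norm_rpow t).indicator Metric.isOpen_ball.measurableSet
  have h1 : ∫⁻ ξ, f (r • ξ) = ENNReal.ofReal (r ^ (-(N : ℝ))) * ∫⁻ ξ, f ξ := by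
    rw [← lintegral_map hf (by fun_prop : Measurable fun ξ : Euc N ↦ r • ξ),
      Measure.map_addHaar_smul volume hr.ne', lintegral_smul_measure, finrank_euclideanSpace_fin,
      abs_of_nonneg (by positivity), Real.rpow_neg hr.le, Real.rpow_natCast, smul_eq_mul]
  have h2 : ∀ ξ, f (r • ξ) = ENNReal.ofReal (r ^ t) *
      (Metric.ball (0 : Euc N) 1).indicator (fun ξ ↦ ENNReal.ofReal (‖ξ‖ ^ t)) ξ := by
    intro ξ
    have h3 : r • ξ ∈ Metric.ball (0 : Euc N) r ↔ ξ ∈ Metric.ball (0 : Euc N) 1 := by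
      simp only [mem_ball_zero_iff, norm_smul, Real.norm_of_nonneg hr.le]
      constructor <;> intro h <;> nlinarith
    by_cases h : ξ ∈ Metric.ball (0 : Euc N) 1
    · simp only [f]
      rw [Set.indicator_of_mem h, Set.indicator_of_mem (h3.2 h), norm_smul,
        Real.norm_of_nonneg hr.le, Real.mul_rpow hr.le (norm_nonneg _),
        ENNReal.ofReal_mul (by positivity)]
    · simp only [f]
      rw [Set.indicator_of_notMem h, Set.indicator_of_notMem (fun h' ↦ h (h3.1 h')), mul_zero]
  simp only [h2] at h1
  rw [lintegral_const_mul' _ _ ENNReal.ofReal_ne_top] at h1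
  rw [Real.rpow_add hr, ENNReal.ofReal_mul (by positivity), mul_assoc, h1, ← mul_assoc,
    ← ENNReal.ofReal_mul (by positivity), ← Real.rpow_add hr]
  simp

theorem lintegral_unitBall_norm_rpow_lt_top {t : ℝ} (ht : 0 < (N : ℝ) + t) (hN : 1 ≤ N) :
    ∫⁻ ξ in Metric.ball (0 : Euc N) 1, ENNReal.ofReal (‖ξ‖ ^ t) < ⊤ := by
  have hm : Measurable fun ξ : Euc N ↦ ‖ξ‖ ^ t := by fun_prop
  have h := integrableOn_ball_of_norm_le_rpow (E := Euc N) (μ := volume) (r := 1) (C := 1)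
    (α := -t) (f := fun ξ ↦ ‖ξ‖ ^ t) (by simpa using hN) (by simp; linarith)
    (ae_of_all _ fun ξ ↦ by simp [abs_of_nonneg (Real.rpow_nonneg (norm_nonneg ξ) t)])
    hm.aestronglyMeasurable
  have := h.lintegral_lt_top
  exact this

/-- Cauchy–Schwarz in frequency after writing `1 = ‖ξ‖^(-s) ‖ξ‖^s` away from the origin. The first
factor is square integrable near `0` when `2s < N`. -/
theorem enorm_multiplier_sq_le {s A : ℝ} (hN : 1 ≤ N)
    {m : SchwartzMap (Euc N) ℂ} (hm : ∀ ξ, ‖m ξ‖ ≤ 1) (hm0 : ∀ ξ, 2 * A ≤ ‖ξ‖ → m ξ = 0)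
    (g : SchwartzMap (Euc N) ℂ) (x : Euc N) :
    ‖multiplier m g x‖ₑ ^ 2 ≤ (∫⁻ ξ in Metric.ball (0 : Euc N) (2 * A),
      ENNReal.ofReal (‖ξ‖ ^ (-(2 * s)))) * schwartzKinetic s g := by
  have hNe : Nontrivial (Euc N) := by
    have : Nonempty (Fin N) := ⟨⟨0, hN⟩⟩
    infer_instance
  set w : Euc N → ℝ≥0∞ := (Metric.ball (0 : Euc N) (2 * A)).indicator
    fun ξ ↦ ENNReal.ofReal (‖ξ‖ ^ (-s))
  have h1 : ∫⁻ ξ, ‖m ξ‖ₑ * ‖𝓕 g ξ‖ₑ ≤ ∫⁻ ξ, (w * fun ξ ↦ ENNReal.ofReal (‖ξ‖ ^ s) * ‖𝓕 g ξ‖ₑ) ξ := by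
    refine lintegral_mono_ae ?_
    have h0 : ∀ᵐ ξ : Euc N, ξ ≠ 0 := Measure.ae_ne volume 0
    filter_upwards [h0] with ξ hξ
    rcases lt_or_ge ‖ξ‖ (2 * A) with h | h
    · have h2 : ‖m ξ‖ₑ ≤ 1 := by
        rw [← ofReal_norm]; exact ENNReal.ofReal_le_one.2 (hm ξ)
      have h3 : 0 < ‖ξ‖ := norm_pos_iff.2 hξ
      simp only [Pi.mul_apply, w]
      rw [Set.indicator_of_mem (by simpa using h), ← mul_assoc,
        ← ENNReal.ofReal_mul (by positivity), ← Real.rpow_add h3]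
      simpa using mul_le_mul_left h2 ‖𝓕 g ξ‖ₑ
    · simp [hm0 ξ h]
  have hwm : Measurable w := (measurable_norm_rpow _).indicator Metric.isOpen_ball.measurableSet
  have hfm : Continuous fun ξ ↦ 𝓕 g ξ := (𝓕 g).continuous
  have h2 := ENNReal.lintegral_mul_le_Lp_mul_Lq volume Real.HolderConjugate.two_two
    hwm.aemeasurable (g := fun ξ ↦ ENNReal.ofReal (‖ξ‖ ^ s) * ‖𝓕 g ξ‖ₑ)
    (((measurable_norm_rpow s).mul hfm.enorm.measurable).aemeasurable)
  have h3 := ((enorm_multiplier_le m g x).trans h1).trans h2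
  have h4 : ∫⁻ ξ, w ξ ^ (2 : ℝ) = ∫⁻ ξ in Metric.ball (0 : Euc N) (2 * A),
      ENNReal.ofReal (‖ξ‖ ^ (-(2 * s))) := by
    rw [← lintegral_indicator Metric.isOpen_ball.measurableSet]
    refine lintegral_congr fun ξ ↦ ?_
    by_cases h : ξ ∈ Metric.ball (0 : Euc N) (2 * A)
    · simp only [w, Set.indicator_of_mem h]
      rw [ENNReal.ofReal_rpow_of_nonneg (by positivity) (by norm_num),
        ← Real.rpow_mul (norm_nonneg _)]
      congr 2; ring
    · simp [w, Set.indicator_of_notMem h]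
  have h5 : ∫⁻ ξ, (ENNReal.ofReal (‖ξ‖ ^ s) * ‖𝓕 g ξ‖ₑ) ^ (2 : ℝ) = schwartzKinetic s g := by
    refine lintegral_congr fun ξ ↦ ?_
    rw [ENNReal.mul_rpow_of_nonneg _ _ (by norm_num),
      ENNReal.ofReal_rpow_of_nonneg (by positivity) (by norm_num), ← Real.rpow_mul (norm_nonneg _),
      ENNReal.rpow_two]
    congr 3; ring
  rw [h4, h5] at h3
  calc _ ≤ _ := pow_le_pow_left' h3 2
    _ = _ := by
      rw [mul_pow, ← ENNReal.rpow_two, ← ENNReal.rpow_two, ← ENNReal.rpow_mul, ← ENNReal.rpow_mul]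
      norm_num

/-! ### Weak-type bound at the critical exponent and the subcritical Sobolev inequality -/

/-- At height `t` the cutoff is chosen so that the low frequency part stays below `t/2`. Where `‖g‖
> t` the high frequency part then exceeds `t/2`, and Chebyshev's inequality in `L²` applies. -/
theorem volume_lt_norm_le {s : ℝ} (hs : 0 < s) (hsN : s < (N : ℝ) / 2) :
    ∃ C : ℝ, 0 ≤ C ∧ ∀ g : SchwartzMap (Euc N) ℂ, schwartzKinetic s g ≤ 1 → ∀ t : ℝ, 0 < t →
      volume {x | t < ‖g x‖} ≤ ENNReal.ofReal (C * t ^ (-critExp N s)) := by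
  have hd : 0 < (N : ℝ) - 2 * s := by linarith
  have hN : 1 ≤ N := by
    rcases Nat.eq_zero_or_pos N with h | h
    · subst h; simp at hsN; linarith
    · exact h
  have hc := lintegral_unitBall_norm_rpow_lt_top (N := N) (t := -(2 * s)) (by linarith) hN
  set c := ∫⁻ ξ in Metric.ball (0 : Euc N) 1, ENNReal.ofReal (‖ξ‖ ^ (-(2 * s))) with hcdef
  -- The added `1` keeps `K` positive, as it is divided by below.
  set K : ℝ := c.toReal + 1 with hK
  have hK0 : 0 < K := by positivity
  have hcK : c ≤ ENNReal.ofReal K := by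
    rw [← ENNReal.ofReal_toReal hc.ne]
    exact ENNReal.ofReal_le_ofReal (by linarith)
  set d := (N : ℝ) - 2 * s with hdd
  refine ⟨4 * (2 ^ (2 * s) * (4 * K) ^ (2 * s / d)), by positivity, fun g hg t ht ↦ ?_⟩
  -- Solves `(2A)^(N-2s) K = (t/2)²`, so the low frequency part is at most `t/2`.
  set A : ℝ := (t ^ 2 / (4 * K)) ^ (1 / d) / 2 with hA
  have hA0 : 0 < A := by positivity
  obtain ⟨m, hm, hm', hm1, hm0⟩ := exists_cutoff (N := N) hA0
  have hsup : ∀ x, ‖multiplier m g x‖ ≤ t / 2 := by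
    intro x
    have h1 := enorm_multiplier_sq_le (s := s) hN hm hm0 g x
    rw [lintegral_ball_norm_rpow (by positivity), ← hcdef] at h1
    have h2 : ‖multiplier m g x‖ₑ ^ 2 ≤ ENNReal.ofReal ((2 * A) ^ ((N : ℝ) + -(2 * s)) * K) := by
      rw [ENNReal.ofReal_mul (by positivity)]
      refine h1.trans ?_
      calc _ ≤ _ * c * 1 := by gcongr
        _ ≤ _ := by rw [mul_one]; gcongr
    have h3 : (2 * A) ^ ((N : ℝ) + -(2 * s)) * K = (t / 2) ^ 2 := by
      have : 2 * A = (t ^ 2 / (4 * K)) ^ (1 / d) := by rw [hA]; ring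
      rw [this, ← sub_eq_add_neg, ← hdd, ← Real.rpow_mul (by positivity), one_div,
        inv_mul_cancel₀ hd.ne', Real.rpow_one]
      field_simp
      norm_num
    rw [h3, ← ofReal_norm, ← ENNReal.ofReal_pow (norm_nonneg _),
      ENNReal.ofReal_le_ofReal_iff (by positivity)] at h2
    exact abs_le_of_sq_le_sq' h2 (by positivity) |>.2
  have hsub : {x | t < ‖g x‖} ⊆
      {x | ENNReal.ofReal ((t / 2) ^ 2) ≤ ‖g x - multiplier m g x‖ₑ ^ 2} := by
    intro x hx
    have h1 : t / 2 ≤ ‖g x - multiplier m g x‖ := by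
      have := norm_sub_norm_le (g x) (multiplier m g x)
      have := hsup x
      have : t < ‖g x‖ := hx
      linarith
    change ENNReal.ofReal _ ≤ _
    rw [← ofReal_norm, ← ENNReal.ofReal_pow (norm_nonneg _)]
    exact ENNReal.ofReal_le_ofReal (pow_le_pow_left₀ (by positivity) h1 2)
  have hmeas : Measurable fun x ↦ ‖g x - multiplier m g x‖ₑ ^ 2 :=
    (g.continuous.sub (multiplier m g).continuous).enorm.measurable.pow_const 2
  have h4 := (mul_meas_ge_le_lintegral hmeas (μ := volume)
    (ENNReal.ofReal ((t / 2) ^ 2))).trans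
    (lintegral_enorm_sq_sub_multiplier_le hs hA0 hm' hm1 g)
  have h5 : ENNReal.ofReal ((t / 2) ^ 2) * volume {x | t < ‖g x‖} ≤
      ENNReal.ofReal (A ^ (-(2 * s))) :=
    calc _ ≤ _ := mul_le_mul_right (measure_mono hsub) _
      _ ≤ _ := h4
      _ ≤ ENNReal.ofReal (A ^ (-(2 * s))) * 1 := by gcongr
      _ = _ := mul_one _
  have h6 : volume {x | t < ‖g x‖} ≤ ENNReal.ofReal (A ^ (-(2 * s)) / (t / 2) ^ 2) := by
    rw [ENNReal.ofReal_div_of_pos (by positivity), ENNReal.le_div_iff_mul_le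
      (Or.inl (by simp; positivity)) (Or.inl ENNReal.ofReal_ne_top), mul_comm]
    exact h5
  refine h6.trans (ENNReal.ofReal_le_ofReal (le_of_eq ?_))
  -- Chebyshev contributes `t^(-2)` and `A^(-2s)` contributes `t^(-4s/(N-2s))`; together they give
  -- the critical exponent.
  have hcrit : -critExp N s = -2 + 2 * (-(2 * s / d)) := by
    rw [critExp, ← hdd]; field_simp; rw [hdd]; ring
  have h7 : A ^ (-(2 * s)) = 2 ^ (2 * s) * (4 * K) ^ (2 * s / d) * (t ^ (2 * (-(2 * s / d)))) := by
    rw [hA, Real.div_rpow (by positivity) (by positivity), ← Real.rpow_mul (by positivity),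
      Real.div_rpow (by positivity) (by positivity), Real.rpow_mul ht.le, Real.rpow_two,
      Real.rpow_neg (by positivity) (2 * s),
      show 1 / d * -(2 * s) = -(2 * s / d) by ring, Real.rpow_neg (by positivity : 0 ≤ 4 * K)]
    field_simp
  rw [h7, hcrit, Real.rpow_add ht, Real.rpow_neg ht.le 2, Real.rpow_two]
  field_simp
  norm_num

/-- The subcritical Sobolev inequality, normalised. -/
theorem lintegral_rpow_le_of_le_one {s θ : ℝ} (hs : 0 < s) (hsN : s < (N : ℝ) / 2)
    (hθ : 2 ≤ θ) (hθ' : θ < critExp N s) :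
    ∃ C : ℝ≥0∞, C ≠ ⊤ ∧ ∀ g : SchwartzMap (Euc N) ℂ, schwartzKinetic s g ≤ 1 →
      ∫⁻ x, ‖g x‖ₑ ^ 2 ≤ 1 → ∫⁻ x, ‖g x‖ₑ ^ θ ≤ C := by
  obtain ⟨C, hC0, hC⟩ := volume_lt_norm_le hs hsN
  have hint : IntegrableOn (fun t : ℝ ↦ C * t ^ (-critExp N s + (θ - 1))) (Set.Ioi 1) :=
    (integrableOn_Ioi_rpow_of_lt (by linarith) one_pos).const_mul C
  refine ⟨ENNReal.ofReal θ * (1 + ∫⁻ t in Set.Ioi (1 : ℝ),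
    ENNReal.ofReal (C * t ^ (-critExp N s + (θ - 1)))),
    ENNReal.mul_ne_top ENNReal.ofReal_ne_top
      (ENNReal.add_ne_top.2 ⟨ENNReal.one_ne_top, hint.lintegral_lt_top.ne⟩), fun g hg hg2 ↦ ?_⟩
  have hgm : AEMeasurable (fun x ↦ ‖g x‖) volume := g.continuous.norm.aemeasurable
  have hpow : ∀ r : ℝ, 0 ≤ r → ∫⁻ x, ENNReal.ofReal (‖g x‖ ^ r) = ∫⁻ x, ‖g x‖ₑ ^ r := by
    intro r hr
    refine lintegral_congr fun x ↦ ?_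
    rw [← ofReal_norm, ENNReal.ofReal_rpow_of_nonneg (norm_nonneg _) hr]
  have h2 := lintegral_rpow_eq_lintegral_meas_lt_mul volume (ae_of_all _ fun x ↦ norm_nonneg (g x))
    hgm (p := 2) two_pos
  have h3 := lintegral_rpow_eq_lintegral_meas_lt_mul volume (ae_of_all _ fun x ↦ norm_nonneg (g x))
    hgm (p := θ) (by linarith)
  rw [← hpow θ (by linarith), h3]
  gcongr
  rw [← Set.Ioc_union_Ioi_eq_Ioi zero_le_one]
  -- Layer cake: heights below `1` are absorbed by the `L²` norm, as `t^(θ-1) ≤ t`. Above `1` the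
  -- weak-type bound leaves the exponent `θ - 1 - 2*_s < -1`.
  refine (lintegral_union_le _ _ _).trans (add_le_add ?_ ?_)
  · rw [hpow 2 (by norm_num)] at h2
    simp only [ENNReal.rpow_two] at h2
    rw [h2] at hg2
    refine le_trans ?_ hg2
    have h4 : (1 : ℝ≥0∞) ≤ ENNReal.ofReal 2 := by simp
    refine le_trans ?_ (le_mul_of_one_le_left' h4)
    refine (setLIntegral_mono_ae' measurableSet_Ioc (ae_of_all _ fun t ht ↦ ?_)).trans
      (lintegral_mono_set Set.Ioc_subset_Ioi_self)
    exact mul_le_mul_right (ENNReal.ofReal_le_ofReal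
      (Real.rpow_le_rpow_of_exponent_ge ht.1 ht.2 (by linarith))) _
  · refine setLIntegral_mono_ae' measurableSet_Ioi (ae_of_all _ fun t ht ↦ ?_)
    have ht0 : (0 : ℝ) < t := zero_lt_one.trans ht
    rw [Real.rpow_add ht0, ← mul_assoc, ENNReal.ofReal_mul (by positivity)]
    gcongr
    exact hC g hg t ht0

theorem schwartzKinetic_smul (s : ℝ) (c : ℂ) (g : SchwartzMap (Euc N) ℂ) :
    schwartzKinetic s (c • g) = ‖c‖ₑ ^ 2 * schwartzKinetic s g := by
  unfold schwartzKinetic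
  rw [FourierTransform.fourier_smul, ← lintegral_const_mul' _ _ (by simp)]
  refine lintegral_congr fun ξ ↦ ?_
  rw [smul_apply, enorm_smul]
  ring

/-- The subcritical Sobolev inequality. -/
theorem exists_lintegral_rpow_le {s θ : ℝ} (hs : 0 < s) (hsN : s < (N : ℝ) / 2)
    (hθ : 2 ≤ θ) (hθ' : θ < critExp N s) :
    ∃ C : ℝ≥0∞, C ≠ ⊤ ∧ ∀ (g : SchwartzMap (Euc N) ℂ) (D : ℝ), 0 < D →
      schwartzKinetic s g ≤ ENNReal.ofReal (D ^ 2) → ∫⁻ x, ‖g x‖ₑ ^ 2 ≤ ENNReal.ofReal (D ^ 2) →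
        ∫⁻ x, ‖g x‖ₑ ^ θ ≤ C * ENNReal.ofReal (D ^ θ) := by
  obtain ⟨C, hC, h⟩ := lintegral_rpow_le_of_le_one hs hsN hθ hθ'
  refine ⟨C, hC, fun g D hD hk h2 ↦ ?_⟩
  have hn : ‖((D⁻¹ : ℝ) : ℂ)‖ₑ = ENNReal.ofReal D⁻¹ := by
    rw [← ofReal_norm, Complex.norm_real, Real.norm_of_nonneg (by positivity)]
  have h1 : ENNReal.ofReal D⁻¹ ^ 2 * ENNReal.ofReal (D ^ 2) = 1 := by
    rw [← ENNReal.ofReal_pow (by positivity), ← ENNReal.ofReal_mul (by positivity), ← mul_pow,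
      inv_mul_cancel₀ hD.ne']
    simp
  have h3 := h (((D⁻¹ : ℝ) : ℂ) • g) ?_ ?_
  · simp only [smul_apply, enorm_smul, hn] at h3
    simp only [ENNReal.mul_rpow_of_nonneg _ _ (by linarith : 0 ≤ θ)] at h3
    rw [lintegral_const_mul' _ _ (ENNReal.rpow_ne_top_of_nonneg (by linarith)
      ENNReal.ofReal_ne_top)] at h3
    have h4 : ENNReal.ofReal (D ^ θ) * ENNReal.ofReal D⁻¹ ^ θ = 1 := by
      rw [ENNReal.ofReal_rpow_of_nonneg (by positivity) (by linarith),
        ← ENNReal.ofReal_mul (by positivity), ← Real.mul_rpow (by positivity) (by positivity),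
        mul_inv_cancel₀ hD.ne']
      simp
    calc _ = ENNReal.ofReal (D ^ θ) * (ENNReal.ofReal D⁻¹ ^ θ * ∫⁻ x, ‖g x‖ₑ ^ θ) := by
          rw [← mul_assoc, h4, one_mul]
      _ ≤ ENNReal.ofReal (D ^ θ) * C := by gcongr
      _ = _ := mul_comm _ _
  · rw [schwartzKinetic_smul, hn, ← h1]
    gcongr
  · simp only [smul_apply, enorm_smul, hn, mul_pow]
    rw [lintegral_const_mul' _ _ (by simp), ← h1]
    gcongr

/-! ### Localisation by translated windows -/

theorem fourierInv_schwartz_apply (g : SchwartzMap (Euc N) ℂ) (x : Euc N) :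
    𝓕⁻ g x = 𝓕 g (-x) := by
  rw [SchwartzMap.fourierInv_coe, SchwartzMap.fourier_coe, Real.fourierInv_eq_fourier_neg]

/-- The convolution theorem applied to `𝓕⁻ a` and `𝓕⁻ b`; since `𝓕⁻` is `𝓕` followed by a
reflection, two sign changes turn it into this form. -/
theorem fourier_pairing_mul (a b : SchwartzMap (Euc N) ℂ) (ξ : Euc N) :
    𝓕 (SchwartzMap.pairing (ContinuousLinearMap.mul ℂ ℂ) a b) ξ = ∫ ζ, 𝓕 a ζ * 𝓕 b (ξ - ζ) := by
  have h1 : SchwartzMap.convolution (ContinuousLinearMap.mul ℂ ℂ) (𝓕⁻ a) (𝓕⁻ b) =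
      𝓕⁻ (SchwartzMap.pairing (ContinuousLinearMap.mul ℂ ℂ) a b) := by
    have := SchwartzMap.fourier_convolution (ContinuousLinearMap.mul ℂ ℂ) (𝓕⁻ a) (𝓕⁻ b)
    rw [FourierTransform.fourier_fourierInv_eq, FourierTransform.fourier_fourierInv_eq] at this
    rw [← this, FourierTransform.fourierInv_fourier_eq]
  have h2 := fourierInv_schwartz_apply (SchwartzMap.pairing (ContinuousLinearMap.mul ℂ ℂ) a b) (-ξ)
  rw [neg_neg, ← h1, SchwartzMap.convolution_apply] at h2
  rw [← h2, ← integral_neg_eq_self]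
  refine integral_congr_ae (ae_of_all _ fun t ↦ ?_)
  simp only [ContinuousLinearMap.mul_apply', fourierInv_schwartz_apply]
  congr 2
  simp [add_comm]

/-- `x ↦ χ(x - y) g(x)`. -/
def localize (χ g : SchwartzMap (Euc N) ℂ) (y : Euc N) : SchwartzMap (Euc N) ℂ :=
  SchwartzMap.pairing (ContinuousLinearMap.mul ℂ ℂ) (SchwartzMap.compSubConstCLM ℂ y χ) g

theorem fourier_compSubConst (χ : SchwartzMap (Euc N) ℂ) (y ζ : Euc N) :
    𝓕 (SchwartzMap.compSubConstCLM ℂ y χ) ζ = Real.fourierChar (-inner ℝ ζ y) • 𝓕 χ ζ := by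
  rw [SchwartzMap.fourier_coe, SchwartzMap.fourier_coe, Real.fourier_eq, Real.fourier_eq,
    ← integral_add_right_eq_self _ y, Circle.smul_def (Real.fourierChar (-inner ℝ ζ y)),
    ← integral_smul]
  refine integral_congr_ae (ae_of_all _ fun t ↦ ?_)
  simp only [SchwartzMap.compSubConstCLM_apply, add_sub_cancel_right, ← Circle.smul_def, smul_smul]
  rw [← AddChar.map_add_eq_mul, inner_add_left, real_inner_comm ζ y]
  congr 2
  ring

theorem fourier_localize (χ g : SchwartzMap (Euc N) ℂ) (y ξ : Euc N) :
    𝓕 (localize χ g y) ξ = ∫ ζ, Real.fourierChar (-inner ℝ ζ y) • (𝓕 χ ζ * 𝓕 g (ξ - ζ)) := by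
  rw [localize, fourier_pairing_mul]
  refine integral_congr_ae (ae_of_all _ fun t ↦ ?_)
  simp only [fourier_compSubConst, smul_mul_assoc]

theorem measurable_fourier_localize (χ g : SchwartzMap (Euc N) ℂ) :
    Measurable fun p : Euc N × Euc N ↦ 𝓕 (localize χ g p.1) p.2 := by
  simp only [fourier_localize]
  have h1 := (𝓕 χ).continuous
  have h2 := (𝓕 g).continuous
  have h3 : Continuous fun q : (Euc N × Euc N) × Euc N ↦
      Real.fourierChar (-inner ℝ q.2 q.1.1) • (𝓕 χ q.2 * 𝓕 g (q.1.2 - q.2)) := by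
    have := Real.continuous_fourierChar
    fun_prop
  exact (StronglyMeasurable.integral_prod_right' h3.stronglyMeasurable).measurable

/-- For fixed `ξ`, the function of `y` is itself the Fourier transform of the Schwartz function `ζ ↦
𝓕 χ ζ * 𝓕 g (ξ - ζ)`, so Plancherel applies in the translation variable. -/
theorem lintegral_enorm_sq_fourier_localize (χ g : SchwartzMap (Euc N) ℂ) (ξ : Euc N) :
    ∫⁻ y, ‖𝓕 (localize χ g y) ξ‖ₑ ^ 2 = ∫⁻ ζ, ‖𝓕 χ ζ‖ₑ ^ 2 * ‖𝓕 g (ξ - ζ)‖ₑ ^ 2 := by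
  set k := SchwartzMap.pairing (ContinuousLinearMap.mul ℂ ℂ) (𝓕 χ)
    (SchwartzMap.compSubConstCLM ℂ ξ (𝓕⁻ g))
  have hk : ∀ ζ, k ζ = 𝓕 χ ζ * 𝓕 g (ξ - ζ) := by
    intro ζ
    change 𝓕 χ ζ * (𝓕⁻ g) (ζ - ξ) = _
    rw [fourierInv_schwartz_apply, neg_sub]
  have h1 : ∀ y, 𝓕 (localize χ g y) ξ = 𝓕 k y := by
    intro y
    rw [fourier_localize, SchwartzMap.fourier_coe k, Real.fourier_eq]
    simp only [hk]
  simp only [h1, lintegral_enorm_sq_fourier, hk, enorm_mul, mul_pow]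

theorem norm_rpow_le_add {t : ℝ} (ht : 0 ≤ t) (ξ ζ : Euc N) :
    ‖ξ‖ ^ t ≤ 2 ^ t * (‖ξ - ζ‖ ^ t + ‖ζ‖ ^ t) := by
  have h1 : ‖ξ‖ ≤ ‖ξ - ζ‖ + ‖ζ‖ := by simpa using norm_add_le (ξ - ζ) ζ
  have h2 : ‖ξ‖ ≤ 2 * max ‖ξ - ζ‖ ‖ζ‖ := by
    linarith [le_max_left ‖ξ - ζ‖ ‖ζ‖, le_max_right ‖ξ - ζ‖ ‖ζ‖]
  refine (Real.rpow_le_rpow (norm_nonneg _) h2 ht).trans ?_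
  rw [Real.mul_rpow (by norm_num) (by positivity)]
  gcongr
  rcases max_cases ‖ξ - ζ‖ ‖ζ‖ with ⟨h, -⟩ | ⟨h, -⟩ <;> rw [h]
  · linarith [Real.rpow_nonneg (norm_nonneg ζ) t]
  · linarith [Real.rpow_nonneg (norm_nonneg (ξ - ζ)) t]

/-- Localising by a translated window costs, on average over the translations, at most a multiple of
the full fractional Sobolev norm. -/
theorem lintegral_schwartzKinetic_localize_le {s : ℝ} (hs : 0 ≤ s)
    (χ g : SchwartzMap (Euc N) ℂ) :
    ∫⁻ y, schwartzKinetic s (localize χ g y) ≤ ENNReal.ofReal (2 ^ (2 * s)) *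
      ((∫⁻ x, ‖χ x‖ₑ ^ 2) * schwartzKinetic s g + schwartzKinetic s χ * ∫⁻ x, ‖g x‖ₑ ^ 2) := by
  have hχ : Measurable fun ζ ↦ ‖𝓕 χ ζ‖ₑ ^ 2 := (𝓕 χ).continuous.enorm.measurable.pow_const 2
  have hg : Measurable fun ζ ↦ ‖𝓕 g ζ‖ₑ ^ 2 := (𝓕 g).continuous.enorm.measurable.pow_const 2
  have hw := measurable_norm_rpow (N := N) (2 * s)
  have hm := measurable_fourier_localize χ g
  calc ∫⁻ y, schwartzKinetic s (localize χ g y)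
      = ∫⁻ ξ, ∫⁻ y, ENNReal.ofReal (‖ξ‖ ^ (2 * s)) * ‖𝓕 (localize χ g y) ξ‖ₑ ^ 2 := by
        refine lintegral_lintegral_swap ?_
        exact ((hw.comp measurable_snd).mul (hm.enorm.pow_const 2)).aemeasurable
    _ = ∫⁻ ξ, ∫⁻ ζ, ENNReal.ofReal (‖ξ‖ ^ (2 * s)) *
          (‖𝓕 χ ζ‖ₑ ^ 2 * ‖𝓕 g (ξ - ζ)‖ₑ ^ 2) := by
        refine lintegral_congr fun ξ ↦ ?_
        rw [lintegral_const_mul' _ _ ENNReal.ofReal_ne_top, lintegral_enorm_sq_fourier_localize,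
          lintegral_const_mul' _ _ ENNReal.ofReal_ne_top]
    -- Splitting `ξ = (ξ - ζ) + ζ` puts the weight either on `g` or on the window; after translation
    -- in `ξ` both double integrals factorise.
    _ ≤ ∫⁻ ξ, ∫⁻ ζ, ENNReal.ofReal (2 ^ (2 * s)) *
          (‖𝓕 χ ζ‖ₑ ^ 2 * (ENNReal.ofReal (‖ξ - ζ‖ ^ (2 * s)) * ‖𝓕 g (ξ - ζ)‖ₑ ^ 2) +
          (ENNReal.ofReal (‖ζ‖ ^ (2 * s)) * ‖𝓕 χ ζ‖ₑ ^ 2) * ‖𝓕 g (ξ - ζ)‖ₑ ^ 2) := by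
        refine lintegral_mono fun ξ ↦ lintegral_mono fun ζ ↦ ?_
        have h1 := ENNReal.ofReal_le_ofReal
          (norm_rpow_le_add (by positivity : 0 ≤ 2 * s) ξ ζ)
        rw [ENNReal.ofReal_mul (by positivity), ENNReal.ofReal_add (by positivity)
          (by positivity)] at h1
        calc _ ≤ _ * (‖𝓕 χ ζ‖ₑ ^ 2 * ‖𝓕 g (ξ - ζ)‖ₑ ^ 2) := mul_le_mul_left h1 _
          _ = _ := by ring
    _ = ∫⁻ ζ, ∫⁻ ξ, ENNReal.ofReal (2 ^ (2 * s)) *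
          (‖𝓕 χ ζ‖ₑ ^ 2 * (ENNReal.ofReal (‖ξ - ζ‖ ^ (2 * s)) * ‖𝓕 g (ξ - ζ)‖ₑ ^ 2) +
          (ENNReal.ofReal (‖ζ‖ ^ (2 * s)) * ‖𝓕 χ ζ‖ₑ ^ 2) * ‖𝓕 g (ξ - ζ)‖ₑ ^ 2) := by
        refine lintegral_lintegral_swap ?_
        have hsub : Measurable fun p : Euc N × Euc N ↦ p.1 - p.2 := measurable_fst.sub measurable_snd
        exact ((((hχ.comp measurable_snd).mul ((hw.comp hsub).mul (hg.comp hsub))).add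
          (((hw.comp measurable_snd).mul (hχ.comp measurable_snd)).mul
            (hg.comp hsub))).const_mul _).aemeasurable
    _ = ENNReal.ofReal (2 ^ (2 * s)) * ∫⁻ ζ, (‖𝓕 χ ζ‖ₑ ^ 2 * schwartzKinetic s g +
          (ENNReal.ofReal (‖ζ‖ ^ (2 * s)) * ‖𝓕 χ ζ‖ₑ ^ 2) * ∫⁻ x, ‖g x‖ₑ ^ 2) := by
        rw [← lintegral_const_mul' _ _ ENNReal.ofReal_ne_top]
        refine lintegral_congr fun ζ ↦ ?_
        rw [lintegral_const_mul' _ _ ENNReal.ofReal_ne_top]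
        congr 1
        have hsub : Measurable fun ξ : Euc N ↦ ξ - ζ := measurable_id.sub_const ζ
        have h1 : Measurable fun ξ : Euc N ↦
            ENNReal.ofReal (‖ξ - ζ‖ ^ (2 * s)) * ‖𝓕 g (ξ - ζ)‖ₑ ^ 2 :=
          (hw.comp hsub).mul (hg.comp hsub)
        have h2 : Measurable fun ξ : Euc N ↦ ‖𝓕 g (ξ - ζ)‖ₑ ^ 2 := hg.comp hsub
        rw [lintegral_add_left (h1.const_mul _), lintegral_const_mul _ h1,
          lintegral_const_mul _ h2, ← lintegral_enorm_sq_fourier g]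
        congr 2
        · exact lintegral_sub_right_eq_self
            (fun ξ ↦ ENNReal.ofReal (‖ξ‖ ^ (2 * s)) * ‖𝓕 g ξ‖ₑ ^ 2) ζ
        · exact lintegral_sub_right_eq_self (fun ξ ↦ ‖𝓕 g ξ‖ₑ ^ 2) ζ
    _ = _ := by
        have h1 : Measurable fun ζ : Euc N ↦
            ENNReal.ofReal (‖ζ‖ ^ (2 * s)) * ‖𝓕 χ ζ‖ₑ ^ 2 := hw.mul hχ
        rw [lintegral_add_left (hχ.mul_const _), lintegral_mul_const _ hχ,
          lintegral_mul_const _ h1, lintegral_enorm_sq_fourier χ]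
        rfl

/-! ### What the energy norm controls on test functions -/

theorem toSchwartz_apply (φ : testFunctions N) (x : Euc N) :
    toSchwartz φ x = ((φ : Euc N → ℝ) x : ℂ) := rfl

theorem enorm_toSchwartz (φ : testFunctions N) (x : Euc N) :
    ‖toSchwartz φ x‖ₑ = ‖(φ : Euc N → ℝ) x‖ₑ := by
  rw [toSchwartz_apply, ← ofReal_norm, ← ofReal_norm, Complex.norm_real]

/-- Substituting `ξ = 2πη`, the Jacobian `(2π)^N` cancels the squared normalisation `(2π)^(-N)`;
only the homogeneity of the weight leaves a factor. -/
theorem kinetic_test (s : ℝ) (φ : testFunctions N) :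
    kinetic s (testToL2 N φ) =
      ENNReal.ofReal ((2 * Real.pi) ^ (2 * s)) * schwartzKinetic s (toSchwartz φ) := by
  have hp : 0 < 2 * Real.pi := by positivity
  set F : Euc N → ℝ≥0∞ := fun η ↦ ENNReal.ofReal ((2 * Real.pi) ^ (2 * s)) *
    (ENNReal.ofReal ((2 * Real.pi) ^ (-(N : ℝ))) *
      (ENNReal.ofReal (‖η‖ ^ (2 * s)) * ‖𝓕 (toSchwartz φ) η‖ₑ ^ 2)) with hF
  have hFm : Measurable F := by
    have h1 : Measurable fun η ↦ ‖𝓕 (toSchwartz φ) η‖ₑ ^ 2 :=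
      (𝓕 (toSchwartz φ)).continuous.enorm.measurable.pow_const 2
    exact (((measurable_norm_rpow (N := N) (2 * s)).mul h1).const_mul _).const_mul _
  have h1 : kinetic s (testToL2 N φ) = ∫⁻ ξ : Euc N, F ((2 * Real.pi)⁻¹ • ξ) := by
    refine lintegral_congr_ae ?_
    filter_upwards [fourier_test φ] with ξ hξ
    have h2 : ‖ξ‖ ^ (2 * s) = (2 * Real.pi) ^ (2 * s) * ‖(2 * Real.pi)⁻¹ • ξ‖ ^ (2 * s) := by
      rw [norm_smul, Real.norm_of_nonneg (by positivity),
        ← Real.mul_rpow hp.le (by positivity), mul_inv_cancel_left₀ hp.ne']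
    have h3 : ((2 * Real.pi) ^ (-(N : ℝ) / 2)) ^ 2 = (2 * Real.pi) ^ (-(N : ℝ)) := by
      rw [← Real.rpow_natCast, ← Real.rpow_mul hp.le]
      congr 1; push_cast; ring
    rw [hξ, h2, norm_mul, Complex.norm_real, Real.norm_of_nonneg (by positivity), mul_pow, h3, hF]
    simp only [← ofReal_norm (𝓕 (toSchwartz φ) _)]
    rw [← ENNReal.ofReal_pow (norm_nonneg _), ← ENNReal.ofReal_mul (by positivity),
      ← ENNReal.ofReal_mul (by positivity), ← ENNReal.ofReal_mul (by positivity)]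
    congr 1; ring
  rw [h1, ← lintegral_map hFm (by fun_prop : Measurable fun ξ : Euc N ↦ (2 * Real.pi)⁻¹ • ξ),
    Measure.map_addHaar_smul volume (by positivity), lintegral_smul_measure,
    finrank_euclideanSpace_fin, hF, lintegral_const_mul' _ _ ENNReal.ofReal_ne_top,
    lintegral_const_mul' _ _ ENNReal.ofReal_ne_top, ← schwartzKinetic, smul_eq_mul, mul_left_comm]
  congr 1
  rw [← mul_assoc, ← ENNReal.ofReal_mul (by positivity), inv_pow, inv_inv, abs_of_nonneg
    (by positivity), Real.rpow_neg hp.le, Real.rpow_natCast, mul_inv_cancel₀ (by positivity)]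
  simp

theorem lintegral_enorm_sq_test (φ : testFunctions N) :
    ∫⁻ x, ‖(φ : Euc N → ℝ) x‖ₑ ^ 2 = ENNReal.ofReal (‖testToL2 N φ‖ ^ 2) := by
  have h : ‖testToL2 N φ‖ = (eLpNorm (φ : Euc N → ℝ) 2 volume).toReal :=
    Lp.norm_toLp _ (testFunctions_memLp φ)
  rw [h, ← ENNReal.toReal_pow, ENNReal.ofReal_toReal
    (ENNReal.pow_ne_top (testFunctions_memLp φ).2.ne),
    eLpNorm_eq_lintegral_rpow_enorm_toReal two_ne_zero ENNReal.ofNat_ne_top, ← ENNReal.rpow_natCast,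
    ← ENNReal.rpow_mul]
  norm_num

theorem LocBounded.aestronglyMeasurable {V : Euc N → ℝ} (hV : LocBounded V) :
    AEStronglyMeasurable V volume := by
  have h : AEStronglyMeasurable V
      (volume.restrict (⋃ n : ℕ, Metric.closedBall (0 : Euc N) n)) :=
    aestronglyMeasurable_iUnion_iff.2 fun n ↦ (hV _ (isCompact_closedBall 0 (n : ℝ))).1
  rwa [Metric.iUnion_closedBall_nat, Measure.restrict_univ] at h

/-- From `V⁺ ≤ V + B` the kinetic and `V⁺` terms together are at most the energy plus `B ‖φ‖₂²`, and
coercivity absorbs the last term. -/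
theorem CondV2.exists_bound {s : ℝ} {V : Euc N → ℝ} (hs : 0 < s) (hV1 : CondV1 V)
    (hV : CondV2 s V) : ∃ C : ℝ, 0 < C ∧ ∀ φ : TestSpace hs hV,
      schwartzKinetic s (toSchwartz φ.val) ≤ ENNReal.ofReal ((C * ‖φ‖) ^ 2) ∧
      ∫⁻ x, ENNReal.ofReal (max 0 (V x)) * ‖(φ.val : Euc N → ℝ) x‖ₑ ^ 2 ≤
        ENNReal.ofReal ((C * ‖φ‖) ^ 2) ∧
      ∫⁻ x, ‖(φ.val : Euc N → ℝ) x‖ₑ ^ 2 ≤ ENNReal.ofReal ((C * ‖φ‖) ^ 2) := by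
  obtain ⟨B, hB, hVB⟩ := hV1
  obtain ⟨κ, hκ, hcoer⟩ := hV.coercive
  have hp : 1 ≤ 2 * Real.pi := by linarith [Real.pi_gt_three]
  -- `1` pays for the energy, `B / κ` for the negative part of `V`, and the last `1 / κ` for the
  -- `L²` norm.
  set D : ℝ := 1 + B / κ + 1 / κ with hD
  have hD0 : 0 < D := by positivity
  refine ⟨Real.sqrt D, Real.sqrt_pos.2 hD0, fun φ ↦ ?_⟩
  rw [mul_pow, Real.sq_sqrt hD0.le]
  have h1 := hcoer φ.val
  rw [form_self, ← TestSpace.norm_sq hs hV φ] at h1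
  have hL2 : ‖testToL2 N φ.val‖ ^ 2 ≤ ‖φ‖ ^ 2 / κ := by
    rw [le_div_iff₀ hκ]; linarith
  have hTi : Integrable (fun ξ : Euc N ↦ ‖ξ‖ ^ (2 * s) * ‖fourier (testToL2 N φ.val) ξ‖ ^ 2) := by
    refine (integrable_kinetic hs.le φ.val φ.val).congr (ae_of_all _ fun ξ ↦ ?_)
    simp only [Complex.mul_conj, Complex.ofReal_re, Complex.normSq_eq_norm_sq]
  have hVi : Integrable (fun x : Euc N ↦ V x * testToL2 N φ.val x ^ 2) := by
    refine (integrable_potential hV.locBounded φ.val φ.val).congr (ae_of_all _ fun ξ ↦ ?_)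
    simp only [sq]
  have hφi : Integrable (fun x : Euc N ↦ testToL2 N φ.val x ^ 2) :=
    (memLp_two_iff_integrable_sq (Lp.aestronglyMeasurable _)).1 (Lp.memLp _)
  have hφn : ∫ x, testToL2 N φ.val x ^ 2 = ‖testToL2 N φ.val‖ ^ 2 := by
    rw [← real_inner_self_eq_norm_sq, L2.inner_def]
    simp only [real_inner_self_eq_norm_sq, Real.norm_eq_abs, sq_abs]
  set T := ∫ ξ : Euc N, ‖ξ‖ ^ (2 * s) * ‖fourier (testToL2 N φ.val) ξ‖ ^ 2 with hT
  have hT0 : 0 ≤ T := integral_nonneg fun ξ ↦ by positivity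
  have hen : ‖φ‖ ^ 2 = T + ∫ x, V x * testToL2 N φ.val x ^ 2 := TestSpace.norm_sq hs hV φ
  have hPi : Integrable (fun x : Euc N ↦ max 0 (V x) * testToL2 N φ.val x ^ 2) := by
    refine ((hVi.norm)).mono' ((aemeasurable_const.max
      hV.locBounded.aestronglyMeasurable.aemeasurable).aestronglyMeasurable.mul
        hφi.aestronglyMeasurable) (ae_of_all _ fun x ↦ ?_)
    rw [norm_mul, norm_mul]
    gcongr
    rw [Real.norm_of_nonneg (le_max_left _ _)]
    exact max_le (norm_nonneg _) (le_abs_self _)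
  have hPle : ∫ x, max 0 (V x) * testToL2 N φ.val x ^ 2 ≤
      (∫ x, V x * testToL2 N φ.val x ^ 2) + B * ‖testToL2 N φ.val‖ ^ 2 := by
    rw [← hφn, ← integral_const_mul, ← integral_add hVi (hφi.const_mul B)]
    refine integral_mono_ae hPi (hVi.add (hφi.const_mul B)) ?_
    filter_upwards [hVB] with x hx
    rw [← add_mul]
    gcongr
    exact max_le (by linarith) (by linarith)
  have hP0 : 0 ≤ ∫ x, max 0 (V x) * testToL2 N φ.val x ^ 2 :=
    integral_nonneg fun x ↦ mul_nonneg (le_max_left _ _) (sq_nonneg _)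
  have hsum : T + ∫ x, max 0 (V x) * testToL2 N φ.val x ^ 2 ≤ D * ‖φ‖ ^ 2 := by
    have : B * ‖testToL2 N φ.val‖ ^ 2 ≤ B * (‖φ‖ ^ 2 / κ) := by gcongr
    have h3 : D * ‖φ‖ ^ 2 = ‖φ‖ ^ 2 + B * (‖φ‖ ^ 2 / κ) + ‖φ‖ ^ 2 / κ := by rw [hD]; ring
    have : 0 ≤ ‖φ‖ ^ 2 / κ := by positivity
    linarith
  refine ⟨?_, ?_, ?_⟩
  · have h2 : kinetic s (testToL2 N φ.val) = ENNReal.ofReal T :=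
      (ofReal_integral_eq_lintegral_ofReal hTi (ae_of_all _ fun ξ ↦ by positivity)).symm
    rw [kinetic_test] at h2
    have h3 : (1 : ℝ≥0∞) ≤ ENNReal.ofReal ((2 * Real.pi) ^ (2 * s)) :=
      ENNReal.one_le_ofReal.2 (Real.one_le_rpow hp (by positivity))
    exact (le_mul_of_one_le_left' h3).trans (h2.le.trans (ENNReal.ofReal_le_ofReal (by linarith)))
  · refine le_trans (le_of_eq ?_) (ENNReal.ofReal_le_ofReal (by linarith :
      ∫ x, max 0 (V x) * testToL2 N φ.val x ^ 2 ≤ D * ‖φ‖ ^ 2))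
    rw [ofReal_integral_eq_lintegral_ofReal hPi
      (ae_of_all _ fun x ↦ mul_nonneg (le_max_left _ _) (sq_nonneg _))]
    refine lintegral_congr_ae ?_
    filter_upwards [testToL2_coe φ.val] with x hx
    rw [hx, ENNReal.ofReal_mul (le_max_left _ _), ← ofReal_norm, ← ENNReal.ofReal_pow
      (norm_nonneg _), Real.norm_eq_abs, sq_abs]
  · rw [lintegral_enorm_sq_test]
    refine ENNReal.ofReal_le_ofReal (hL2.trans ?_)
    rw [hD, add_mul, one_div_mul_eq_div]
    have : 0 ≤ (1 + B / κ) * ‖φ‖ ^ 2 := by positivity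
    linarith

/-! ### Passing from test functions to the completion -/

section Embedding

variable {s : ℝ} {V : Euc N → ℝ} (hs : 0 < s) (hV : CondV2 s V)

theorem HsV.exists_seq (u : HsV hs hV) :
    ∃ φ : ℕ → TestSpace hs hV, Tendsto (fun n ↦ (φ n : HsV hs hV)) atTop (𝓝 u) := by
  have h : u ∈ closure (Set.range ((↑) : TestSpace hs hV → HsV hs hV)) :=
    UniformSpace.Completion.denseRange_coe u
  obtain ⟨x, hx, hxu⟩ := mem_closure_iff_seq_limit.1 h
  choose φ hφ using hx
  exact ⟨φ, by simpa only [hφ] using hxu⟩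

/-- A bound on test functions extends to an inclusion on the completion. -/
theorem HsV.exists_embedding {μ : Measure (Euc N)} (hμ : μ ≪ volume) {θ : ℝ}
    [hθ : Fact (1 ≤ ENNReal.ofReal θ)] {C : ℝ} (hb : ∀ φ : TestSpace hs hV,
      eLpNorm (φ.val : Euc N → ℝ) (ENNReal.ofReal θ) μ ≤ ENNReal.ofReal (C * ‖φ‖)) :
    ∃ T : HsV hs hV →L[ℝ] Lp ℝ (ENNReal.ofReal θ) μ,
      (∀ u, T u =ᵐ[μ] HsV.toL2 hs hV u) ∧
      ∀ φ : TestSpace hs hV, ∀ ε : ℝ, 0 ≤ ε →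
        eLpNorm (φ.val : Euc N → ℝ) (ENNReal.ofReal θ) μ ≤ ENNReal.ofReal ε → ‖T φ‖ ≤ ε := by
  have hmem : ∀ φ : TestSpace hs hV, MemLp (φ.val : Euc N → ℝ) (ENNReal.ofReal θ) μ :=
    fun φ ↦ ⟨φ.val.2.1.continuous.aestronglyMeasurable, (hb φ).trans_lt ENNReal.ofReal_lt_top⟩
  let T₀ : TestSpace hs hV →ₗ[ℝ] Lp ℝ (ENNReal.ofReal θ) μ :=
    { toFun := fun φ ↦ (hmem φ).toLp
      map_add' := fun φ ψ ↦ MemLp.toLp_add (hmem φ) (hmem ψ)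
      map_smul' := fun c φ ↦ MemLp.toLp_const_smul c (hmem φ) }
  have hT₀ : ∀ φ, T₀ φ =ᵐ[μ] (φ.val : Euc N → ℝ) := fun φ ↦ (hmem φ).coeFn_toLp
  have hnorm : ∀ φ, ‖T₀ φ‖ = (eLpNorm (φ.val : Euc N → ℝ) (ENNReal.ofReal θ) μ).toReal :=
    fun φ ↦ Lp.norm_toLp _ (hmem φ)
  have hle : ∀ φ, ‖T₀ φ‖ ≤ max C 0 * ‖φ‖ := by
    intro φ
    rw [hnorm]
    refine ENNReal.toReal_le_of_le_ofReal (by positivity) ((hb φ).trans ?_)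
    gcongr
    exact le_max_left _ _
  let T₁ : TestSpace hs hV →L[ℝ] Lp ℝ (ENNReal.ofReal θ) μ := T₀.mkContinuous _ hle
  let T : HsV hs hV →L[ℝ] Lp ℝ (ENNReal.ofReal θ) μ :=
    T₁.extend (UniformSpace.Completion.toComplL : TestSpace hs hV →L[ℝ] HsV hs hV)
  have hT : ∀ φ : TestSpace hs hV, T (φ : HsV hs hV) = T₀ φ := fun φ ↦
    ContinuousLinearMap.extend_eq T₁
      (e := (UniformSpace.Completion.toComplL : TestSpace hs hV →L[ℝ] HsV hs hV))
      UniformSpace.Completion.denseRange_coe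
      (UniformSpace.Completion.isUniformInducing_coe _) φ
  refine ⟨T, fun u ↦ ?_, fun φ ε hε h ↦ ?_⟩
  · obtain ⟨φ, hφ⟩ := HsV.exists_seq hs hV u
    have h1 : Tendsto (fun n ↦ T (φ n : HsV hs hV)) atTop (𝓝 (T u)) :=
      (T.continuous.tendsto u).comp hφ
    have h2 : Tendsto (fun n ↦ HsV.toL2 hs hV (φ n : HsV hs hV)) atTop (𝓝 (HsV.toL2 hs hV u)) :=
      ((HsV.toL2 hs hV).continuous.tendsto u).comp hφ
    -- The two limits live in different spaces; they are identified along a common subsequence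
    -- converging almost everywhere in both senses.
    obtain ⟨ns, hns, hns'⟩ := (tendstoInMeasure_of_tendsto_Lp h1).exists_seq_tendsto_ae
    obtain ⟨ms, hms, hms'⟩ := (tendstoInMeasure_of_tendsto_Lp
      (h2.comp hns.tendsto_atTop)).exists_seq_tendsto_ae
    have h3 : ∀ᵐ x ∂μ, ∀ n, T (φ n : HsV hs hV) x = HsV.toL2 hs hV (φ n : HsV hs hV) x := by
      rw [ae_all_iff]
      intro n
      rw [hT, HsV.toL2_coe]
      filter_upwards [hT₀ (φ n), hμ.ae_le (testToL2_coe (φ n).val)] with x hx hy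
      rw [hx, hy]
    filter_upwards [hns', hμ.ae_le hms', h3] with x hx hy hxy
    refine tendsto_nhds_unique (hx.comp hms.tendsto_atTop) ?_
    simpa only [Function.comp_def, hxy] using hy
  · rw [hT, hnorm]
    exact ENNReal.toReal_le_of_le_ofReal hε h

theorem embedsContinuously_of_bound {μ : Measure (Euc N)} (hμ : μ ≪ volume) {θ : ℝ}
    (hθ : 1 ≤ θ) {C : ℝ} (hb : ∀ φ : TestSpace hs hV,
      eLpNorm (φ.val : Euc N → ℝ) (ENNReal.ofReal θ) μ ≤ ENNReal.ofReal (C * ‖φ‖)) :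
    EmbedsContinuously hs hV μ θ := by
  have : Fact (1 ≤ ENNReal.ofReal θ) := ⟨ENNReal.one_le_ofReal.2 hθ⟩
  obtain ⟨T, hT, -⟩ := HsV.exists_embedding hs hV hμ hb
  exact ⟨this, T, hT⟩

/-- A finite net for `g '' A` pulls back to one for `f '' A`. The auxiliary map may depend on `ε`,
which permits finite-dimensional comparison maps such as sampling at finitely many points. -/
theorem totallyBounded_image_of_forall_exists {X F : Type*} [PseudoMetricSpace F] {f : X → F}
    {A : Set X} (h : ∀ ε : ℝ, 0 < ε → ∃ (G : Type) (_ : PseudoMetricSpace G) (g : X → G) (δ : ℝ),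
      0 < δ ∧ TotallyBounded (g '' A) ∧
        ∀ x ∈ A, ∀ y ∈ A, dist (g x) (g y) < δ → dist (f x) (f y) < ε) :
    TotallyBounded (f '' A) := by
  rw [Metric.totallyBounded_iff]
  intro ε hε
  obtain ⟨G, _, g, δ, hδ, hg, hfg⟩ := h ε hε
  obtain ⟨t, htA, ht, hcov⟩ := Metric.finite_approx_of_totallyBounded hg δ hδ
  choose r hrA hr using htA
  have := ht.to_subtype
  refine ⟨Set.range fun y : t ↦ f (r y.2), Set.finite_range _, ?_⟩
  rintro _ ⟨x, hx, rfl⟩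
  obtain ⟨y, hy, hxy⟩ := Set.mem_iUnion₂.1 (hcov ⟨x, hx, rfl⟩)
  refine Set.mem_iUnion₂.2 ⟨f (r hy), ⟨⟨y, hy⟩, rfl⟩, hfg x hx _ (hrA hy) ?_⟩
  rwa [hr hy]

/-- Test functions of norm below `1` are dense in the unit ball of the completion, and `F` is
complete, so the closure of the image is compact. -/
theorem isCompactOperator_of_totallyBounded {F : Type*} [NormedAddCommGroup F] [NormedSpace ℝ F]
    [CompleteSpace F] (T : HsV hs hV →L[ℝ] F)
    (h : TotallyBounded ((fun φ : TestSpace hs hV ↦ T φ) '' Metric.ball 0 1)) :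
    IsCompactOperator T := by
  change IsCompactOperator (T : HsV hs hV →ₗ[ℝ] F)
  rw [isCompactOperator_iff_isCompact_closure_image_ball (T : HsV hs hV →ₗ[ℝ] F) one_pos]
  refine (h.closure.isCompact_of_isClosed isClosed_closure).of_isClosed_subset isClosed_closure ?_
  refine closure_minimal ?_ isClosed_closure
  have h1 : Metric.ball (0 : HsV hs hV) 1 ⊆
      closure ((↑) '' (Metric.ball (0 : TestSpace hs hV) 1)) := by
    refine ((UniformSpace.Completion.denseRange_coe (α := TestSpace hs hV)).open_subset_closure_inter
      Metric.isOpen_ball).trans (closure_mono ?_)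
    rintro _ ⟨hx, ⟨φ, rfl⟩⟩
    refine ⟨φ, ?_, rfl⟩
    rw [mem_ball_zero_iff, UniformSpace.Completion.norm_coe] at hx
    rwa [mem_ball_zero_iff]
  refine (Set.image_mono h1).trans ((image_closure_subset_closure_image T.continuous).trans ?_)
  rw [Set.image_image]

/-- If the unit ball of test functions is totally bounded in `L²` and smallness in `L²` forces
smallness in `L^θ(μ)` on bounded sets, then the inclusion into `L^θ(μ)` is compact. -/
theorem embedsCompactly_of_bound {μ : Measure (Euc N)} (hμ : μ ≪ volume) {θ : ℝ}
    (hθ : 1 ≤ θ) {C : ℝ} (hb : ∀ φ : TestSpace hs hV,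
      eLpNorm (φ.val : Euc N → ℝ) (ENNReal.ofReal θ) μ ≤ ENNReal.ofReal (C * ‖φ‖))
    (htb : TotallyBounded (TestSpace.toL2 hs hV '' Metric.ball 0 1))
    (hsmall : ∀ ε : ℝ, 0 < ε → ∃ δ : ℝ, 0 < δ ∧ ∀ φ : TestSpace hs hV, ‖φ‖ ≤ 2 →
      ‖testToL2 N φ.val‖ ≤ δ →
        eLpNorm (φ.val : Euc N → ℝ) (ENNReal.ofReal θ) μ ≤ ENNReal.ofReal ε) :
    EmbedsCompactly hs hV μ θ := by
  have : Fact (1 ≤ ENNReal.ofReal θ) := ⟨ENNReal.one_le_ofReal.2 hθ⟩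
  obtain ⟨T, hT, hTn⟩ := HsV.exists_embedding hs hV hμ hb
  refine ⟨this, T, hT, isCompactOperator_of_totallyBounded hs hV T ?_⟩
  refine totallyBounded_image_of_forall_exists fun ε hε ↦ ?_
  obtain ⟨δ, hδ, hδε⟩ := hsmall (ε / 2) (by positivity)
  refine ⟨L2 N, inferInstance, TestSpace.toL2 hs hV, δ, hδ, htb, fun φ hφ ψ hψ h ↦ ?_⟩
  rw [mem_ball_zero_iff] at hφ hψ
  -- Smallness is needed for differences of elements of the unit ball, hence the radius `2` in the
  -- hypothesis.
  have h1 : ‖φ - ψ‖ ≤ 2 := (norm_sub_le _ _).trans (by linarith)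
  have h2 : ‖testToL2 N (φ - ψ).val‖ ≤ δ := by
    rw [dist_eq_norm, ← map_sub] at h
    exact h.le
  have h3 := hTn _ _ (by positivity) (hδε _ h1 h2)
  rw [dist_eq_norm, ← map_sub, ← UniformSpace.Completion.coe_sub]
  linarith

/-! ### Injectivity of the map into `L²` -/

theorem lintegral_mul_le_of_sq_le {f g : Euc N → ℝ≥0∞}
    (hf : AEMeasurable f) (hg : AEMeasurable g) {A B : ℝ}
    (hA : 0 ≤ A) (hB : 0 ≤ B) (hfA : ∫⁻ x, f x ^ 2 ≤ ENNReal.ofReal (A ^ 2))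
    (hgB : ∫⁻ x, g x ^ 2 ≤ ENNReal.ofReal (B ^ 2)) :
    ∫⁻ x, f x * g x ≤ ENNReal.ofReal (A * B) := by
  have key : ∀ {F : Euc N → ℝ≥0∞} {D : ℝ}, 0 ≤ D → ∫⁻ x, F x ^ 2 ≤ ENNReal.ofReal (D ^ 2) →
      (∫⁻ x, F x ^ (2 : ℝ)) ^ (1 / (2 : ℝ)) ≤ ENNReal.ofReal D := by
    intro F D hD h
    simp only [ENNReal.rpow_two]
    calc _ ≤ ENNReal.ofReal (D ^ 2) ^ (1 / (2 : ℝ)) := by gcongr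
      _ = _ := by
        rw [ENNReal.ofReal_rpow_of_nonneg (by positivity) (by positivity), ← Real.sqrt_eq_rpow,
          Real.sqrt_sq hD]
  rw [ENNReal.ofReal_mul hA]
  exact (ENNReal.lintegral_mul_le_Lp_mul_Lq volume Real.HolderConjugate.two_two hf hg).trans
    (mul_le_mul' (key hA hfA) (key hB hgB))

theorem norm_integral_le_of_enorm_le {E : Type*} [NormedAddCommGroup E] [NormedSpace ℝ E]
    {h : Euc N → E} {f g : Euc N → ℝ≥0∞}
    (hf : AEMeasurable f) (hg : AEMeasurable g) (hfg : ∀ᵐ x, ‖h x‖ₑ ≤ f x * g x) {A B : ℝ}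
    (hA : 0 ≤ A) (hB : 0 ≤ B) (hfA : ∫⁻ x, f x ^ 2 ≤ ENNReal.ofReal (A ^ 2))
    (hgB : ∫⁻ x, g x ^ 2 ≤ ENNReal.ofReal (B ^ 2)) : ‖∫ x, h x‖ ≤ A * B := by
  have h2 := (enorm_integral_le_lintegral_enorm h).trans ((lintegral_mono_ae hfg).trans
    (lintegral_mul_le_of_sq_le hf hg hA hB hfA hgB))
  rwa [← ofReal_norm, ENNReal.ofReal_le_ofReal_iff (by positivity)] at h2

theorem MemLp.exists_lintegral_sq_le {E : Type*} [NormedAddCommGroup E] {f : Euc N → E}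
    (hf : MemLp f 2 volume) :
    ∃ A : ℝ, 0 ≤ A ∧ ∫⁻ x, ‖f x‖ₑ ^ 2 ≤ ENNReal.ofReal (A ^ 2) := by
  refine ⟨(eLpNorm f 2 volume).toReal, ENNReal.toReal_nonneg, le_of_eq ?_⟩
  rw [← ENNReal.toReal_pow, ENNReal.ofReal_toReal (ENNReal.pow_ne_top hf.2.ne),
    eLpNorm_eq_lintegral_rpow_enorm_toReal two_ne_zero ENNReal.ofNat_ne_top, ← ENNReal.rpow_natCast,
    ← ENNReal.rpow_mul]
  norm_num

theorem aestronglyMeasurable_fourier_test (φ : testFunctions N) :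
    AEStronglyMeasurable (fourier (testToL2 N φ)) volume := by
  have := (memLp_weighted_fourier le_rfl φ).1
  simpa using this

/-- Plancherel for the rescaled transform: the case `s = 0` of `kinetic_test`. -/
theorem lintegral_enorm_sq_fourier_test (φ : testFunctions N) :
    ∫⁻ ξ, ‖fourier (testToL2 N φ) ξ‖ₑ ^ 2 = ENNReal.ofReal (‖testToL2 N φ‖ ^ 2) := by
  have h := kinetic_test 0 φ
  simp only [kinetic, schwartzKinetic, mul_zero, Real.rpow_zero, one_mul, ENNReal.ofReal_one] at h
  rw [lintegral_enorm_sq_fourier] at h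
  simp only [enorm_toSchwartz, lintegral_enorm_sq_test] at h
  rw [← h]
  refine lintegral_congr fun ξ ↦ ?_
  rw [ENNReal.ofReal_pow (norm_nonneg _), ofReal_norm]

theorem memLp_potential_mul {V : Euc N → ℝ} (hV : LocBounded V) (ψ : testFunctions N) :
    MemLp (fun x ↦ V x * (ψ : Euc N → ℝ) x) 2 volume := by
  have hK : IsCompact (tsupport (ψ : Euc N → ℝ)) := ψ.2.2
  have h1 := (memLp_indicator_iff_restrict hK.measurableSet).2 (hV _ hK)
  have h2 : MemLp (fun x ↦ (tsupport (ψ : Euc N → ℝ)).indicator V x * (ψ : Euc N → ℝ) x) 2 volume :=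
    (testFunctions_memLp ψ).mul h1
  refine h2.congr_norm (hV.aestronglyMeasurable.mul ψ.2.1.continuous.aestronglyMeasurable)
    (ae_of_all _ fun x ↦ ?_)
  by_cases hx : x ∈ tsupport (ψ : Euc N → ℝ)
  · rw [Set.indicator_of_mem hx]
  · rw [Set.indicator_of_notMem hx, image_eq_zero_of_notMem_tsupport hx]
    simp

/-- The whole weight `‖ξ‖^(2s)` and the potential are put on the fixed function `ψ`, where they stay
in `L²`; Cauchy–Schwarz then needs only the `L²` norm of `φ`. -/
theorem exists_abs_form_le {s : ℝ} (hs : 0 < s) {V : Euc N → ℝ} (hV : LocBounded V)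
    (ψ : testFunctions N) : ∃ C : ℝ, ∀ φ : testFunctions N,
      |form s V (testToL2 N ψ) (testToL2 N φ)| ≤ C * ‖testToL2 N φ‖ := by
  have hw := memLp_weighted_fourier (by positivity : 0 ≤ 2 * s) ψ
  have hv := memLp_potential_mul hV ψ
  obtain ⟨A, hA, hAle⟩ := MemLp.exists_lintegral_sq_le hw
  obtain ⟨B, hB, hBle⟩ := MemLp.exists_lintegral_sq_le hv
  refine ⟨A + B, fun φ ↦ ?_⟩
  rw [add_mul]
  refine (abs_add_le _ _).trans (add_le_add ?_ ?_)
  · rw [← Real.norm_eq_abs]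
    refine norm_integral_le_of_enorm_le hw.1.enorm (aestronglyMeasurable_fourier_test φ).enorm
      (ae_of_all _ fun ξ ↦ ?_) hA (norm_nonneg _) hAle (lintegral_enorm_sq_fourier_test φ).le
    rw [← ofReal_norm, ← ofReal_norm, ← ofReal_norm, ← ENNReal.ofReal_mul (norm_nonneg _),
      norm_mul, norm_mul, Complex.norm_real, mul_assoc]
    refine ENNReal.ofReal_le_ofReal (mul_le_mul_of_nonneg_left ?_ (norm_nonneg _))
    refine (Complex.abs_re_le_norm _).trans ?_
    rw [norm_mul, RCLike.norm_conj]
  · rw [← Real.norm_eq_abs]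
    refine norm_integral_le_of_enorm_le hv.1.enorm φ.2.1.continuous.enorm.aemeasurable
      ?_ hB (norm_nonneg _) hBle (lintegral_enorm_sq_test φ).le
    filter_upwards [testToL2_coe φ, testToL2_coe ψ] with x hx hy
    rw [hx, hy, ← mul_assoc, enorm_mul]

/-- If test functions converge to `u` in energy and to `0` in `L²`, their inner products with a
fixed `ψ` tend to `0` by `exists_abs_form_le`. Thus `u` is orthogonal to a dense subspace. -/
theorem HsV.toL2_injective : Function.Injective (HsV.toL2 hs hV) := by
  refine (injective_iff_map_eq_zero (HsV.toL2 hs hV)).2 fun u hu ↦ ?_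
  have key : ∀ ψ : TestSpace hs hV, inner ℝ (ψ : HsV hs hV) u = 0 := by
    intro ψ
    obtain ⟨C, hC⟩ : ∃ C : ℝ, ∀ φ : TestSpace hs hV, |inner ℝ ψ φ| ≤ C * ‖testToL2 N φ.val‖ := by
      obtain ⟨C, hC⟩ := exists_abs_form_le hs hV.locBounded ψ.val
      exact ⟨C, fun φ ↦ hC φ.val⟩
    obtain ⟨φ, hφ⟩ := HsV.exists_seq hs hV u
    have h2 : Tendsto (fun n ↦ HsV.toL2 hs hV (φ n : HsV hs hV)) atTop (𝓝 (HsV.toL2 hs hV u)) :=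
      ((HsV.toL2 hs hV).continuous.tendsto u).comp hφ
    have h3 : Tendsto (fun n ↦ inner ℝ (ψ : HsV hs hV) (φ n : HsV hs hV)) atTop
        (𝓝 (inner ℝ (ψ : HsV hs hV) u)) := tendsto_const_nhds.inner hφ
    have h4 : Tendsto (fun n ↦ C * ‖HsV.toL2 hs hV (φ n : HsV hs hV)‖) atTop (𝓝 0) := by
      have := h2.norm.const_mul C
      rwa [hu, norm_zero, mul_zero] at this
    refine tendsto_nhds_unique h3 (squeeze_zero_norm (fun n ↦ ?_) h4)
    rw [UniformSpace.Completion.inner_coe, HsV.toL2_coe]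
    exact hC (φ n)
  have h0 : inner ℝ u u = 0 := by
    obtain ⟨φ, hφ⟩ := HsV.exists_seq hs hV u
    have h3 : Tendsto (fun n ↦ inner ℝ (φ n : HsV hs hV) u) atTop (𝓝 (inner ℝ u u)) :=
      hφ.inner tendsto_const_nhds
    simp only [key] at h3
    exact (tendsto_nhds_unique h3 tendsto_const_nhds)
  exact inner_self_eq_zero.1 h0

end Embedding

/-! ### Local compactness in `L²` -/

theorem multiplier_sub (m a b : SchwartzMap (Euc N) ℂ) :
    multiplier m (a - b) = multiplier m a - multiplier m b := by
  have h1 : 𝓕 (a - b) = 𝓕 a - 𝓕 b :=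
    map_sub (FourierTransform.fourierCLM ℂ (SchwartzMap (Euc N) ℂ)) a b
  rw [multiplier, h1, map_sub]
  exact map_sub (FourierTransform.fourierInvCLM ℂ (SchwartzMap (Euc N) ℂ)) _ _

theorem toSchwartz_sub (φ ψ : testFunctions N) :
    toSchwartz (φ - ψ) = toSchwartz φ - toSchwartz ψ := by
  ext x
  rw [sub_apply]
  exact Complex.ofReal_sub _ _

theorem norm_fourierChar_sub_le (a b : ℝ) :
    ‖((Real.fourierChar a : Circle) : ℂ) - (Real.fourierChar b : Circle)‖ ≤
      2 * Real.pi * |a - b| := by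
  have h1 : ((Real.fourierChar a : Circle) : ℂ) - (Real.fourierChar b : Circle) =
      (Real.fourierChar b : Circle) *
        (Complex.exp (Complex.I * ((2 * Real.pi * (a - b) : ℝ) : ℂ)) - 1) := by
    rw [mul_sub, mul_one, Real.fourierChar_apply, Real.fourierChar_apply, ← Complex.exp_add]
    congr 2
    push_cast; ring
  rw [h1, norm_mul, Circle.norm_coe, one_mul]
  refine (Real.norm_exp_I_mul_ofReal_sub_one_le).trans (le_of_eq ?_)
  rw [Real.norm_eq_abs, abs_mul, abs_of_nonneg (by positivity : 0 ≤ 2 * Real.pi)]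

/-- Cauchy–Schwarz on the inversion formula: `m ∈ L²` gives the sup bound and `‖ξ‖ m ∈ L²` the
Lipschitz bound, both from the `L²` norm of `g` alone. -/
theorem exists_norm_multiplier_le (m : SchwartzMap (Euc N) ℂ) :
    ∃ L : ℝ, 0 ≤ L ∧ ∀ (g : SchwartzMap (Euc N) ℂ) (D : ℝ), 0 ≤ D →
      ∫⁻ x, ‖g x‖ₑ ^ 2 ≤ ENNReal.ofReal (D ^ 2) →
        (∀ x, ‖multiplier m g x‖ ≤ L * D) ∧
        ∀ x y, ‖multiplier m g x - multiplier m g y‖ ≤ L * ‖x - y‖ * D := by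
  obtain ⟨A, hA, hAm⟩ := MemLp.exists_lintegral_sq_le (m.memLp 2)
  have hm1 := memLp_weighted_schwartz zero_le_one m
  obtain ⟨B, hB, hBm⟩ := MemLp.exists_lintegral_sq_le hm1
  refine ⟨max A (2 * Real.pi * B), le_max_of_le_left hA, fun g D hD hg ↦ ⟨fun x ↦ ?_, fun x y ↦ ?_⟩⟩
  all_goals rw [← lintegral_enorm_sq_fourier] at hg
  all_goals have hgm : AEMeasurable (fun ξ ↦ ‖𝓕 g ξ‖ₑ) volume := (𝓕 g).continuous.enorm.aemeasurable
  · have h1 : ‖multiplier m g x‖ ≤ A * D := by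
      rw [multiplier_apply]
      refine norm_integral_le_of_enorm_le m.continuous.enorm.aemeasurable hgm
        (ae_of_all _ fun ξ ↦ le_of_eq ?_) hA hD hAm hg
      rw [Circle.smul_def, enorm_smul, enorm_mul, ← ofReal_norm
        ((Real.fourierChar (inner ℝ ξ x) : Circle) : ℂ), Circle.norm_coe]
      simp
    exact h1.trans (by gcongr; exact le_max_left _ _)
  · have hint : ∀ z : Euc N, Integrable
        (fun ξ : Euc N ↦ Real.fourierChar (inner ℝ ξ z) • (m ξ * 𝓕 g ξ)) := by
      intro z
      have h2 : Integrable (fun ξ : Euc N ↦ m ξ * 𝓕 g ξ) :=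
        (SchwartzMap.pairing (ContinuousLinearMap.mul ℂ ℂ) m (𝓕 g)).integrable
      have h3 := (Real.fourierIntegral_convergent_iff (-z)).2 h2
      simpa using h3
    have h1 : ‖multiplier m g x - multiplier m g y‖ ≤ 2 * Real.pi * ‖x - y‖ * B * D := by
      rw [multiplier_apply, multiplier_apply, ← integral_sub (hint x) (hint y)]
      refine norm_integral_le_of_enorm_le
        (f := fun ξ ↦ ENNReal.ofReal (2 * Real.pi * ‖x - y‖) * ‖((‖ξ‖ ^ (1 : ℝ) : ℝ) : ℂ) * m ξ‖ₑ)
        (hm1.1.enorm.const_mul _) hgm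
        (ae_of_all _ fun ξ ↦ ?_) (by positivity) hD ?_ hg
      · rw [Circle.smul_def, Circle.smul_def, ← sub_smul, enorm_smul, enorm_mul, enorm_mul,
          ← mul_assoc, ← mul_assoc]
        gcongr
        rw [← ofReal_norm, ← ofReal_norm, ← ENNReal.ofReal_mul (by positivity)]
        refine ENNReal.ofReal_le_ofReal ((norm_fourierChar_sub_le _ _).trans ?_)
        rw [← inner_sub_right, Complex.norm_real, Real.rpow_one, norm_norm,
          mul_assoc (2 * Real.pi), mul_comm ‖x - y‖]
        exact mul_le_mul_of_nonneg_left (abs_real_inner_le_norm ξ (x - y)) (by positivity)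
      · have hc : 0 ≤ 2 * Real.pi * ‖x - y‖ := by positivity
        generalize 2 * Real.pi * ‖x - y‖ = c at hc
        rw [mul_pow _ B, ENNReal.ofReal_mul (by positivity), ENNReal.ofReal_pow hc]
        refine le_trans (le_of_eq ?_) (mul_le_mul_right hBm _)
        rw [← lintegral_const_mul' _ _ (by simp)]
        simp only [mul_pow]
    refine h1.trans ?_
    calc _ = (2 * Real.pi * B) * ‖x - y‖ * D := by ring
      _ ≤ _ := by gcongr; exact le_max_right _ _

theorem schwartzKinetic_lt_top {s : ℝ} (hs : 0 ≤ s) (g : SchwartzMap (Euc N) ℂ) :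
    schwartzKinetic s g < ⊤ := by
  obtain ⟨A, -, hA⟩ := MemLp.exists_lintegral_sq_le (memLp_weighted_schwartz hs (𝓕 g))
  refine lt_of_le_of_lt (le_of_eq (lintegral_congr fun ξ ↦ ?_)) (hA.trans_lt ENNReal.ofReal_lt_top)
  rw [enorm_mul, mul_pow, ← ofReal_norm ((‖ξ‖ ^ s : ℝ) : ℂ), Complex.norm_real,
    Real.norm_of_nonneg (by positivity), ← ENNReal.ofReal_pow (by positivity),
    ← Real.rpow_mul_natCast (norm_nonneg _)]
  congr 3
  push_cast; ring

/-- A low frequency part which is uniformly small at the points of a fine net is small on the whole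
ball, and the high frequency part is controlled by the kinetic energy. -/
theorem lintegral_enorm_sq_le_of_net {s A R σ : ℝ} (hs : 0 < s) (hA : 0 < A)
    {m : SchwartzMap (Euc N) ℂ} (hm : ∀ ξ, ‖1 - m ξ‖ ≤ 1) (hm1 : ∀ ξ, ‖ξ‖ ≤ A → m ξ = 1)
    (g : SchwartzMap (Euc N) ℂ)
    (hg : ∀ x ∈ Metric.closedBall (0 : Euc N) R, ‖multiplier m g x‖ ≤ σ) :
    ∫⁻ x, ‖g x‖ₑ ^ 2 ≤ 2 * (ENNReal.ofReal (A ^ (-(2 * s))) * schwartzKinetic s g) +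
      2 * (ENNReal.ofReal (σ ^ 2) * volume (Metric.closedBall (0 : Euc N) R)) +
      ∫⁻ x in (Metric.closedBall (0 : Euc N) R)ᶜ, ‖g x‖ₑ ^ 2 := by
  rw [← lintegral_add_compl (fun x ↦ ‖g x‖ₑ ^ 2) (Metric.isClosed_closedBall (x := (0 : Euc N))
    (ε := R)).measurableSet]
  gcongr
  have hsub : Measurable fun x ↦ ‖g x - multiplier m g x‖ₑ ^ 2 :=
    (g.continuous.sub (multiplier m g).continuous).enorm.measurable.pow_const 2
  calc ∫⁻ x in Metric.closedBall (0 : Euc N) R, ‖g x‖ₑ ^ 2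
      ≤ ∫⁻ x in Metric.closedBall (0 : Euc N) R,
          (2 * ‖g x - multiplier m g x‖ₑ ^ 2 + 2 * ENNReal.ofReal (σ ^ 2)) := by
        refine setLIntegral_mono_ae' Metric.isClosed_closedBall.measurableSet
          (ae_of_all _ fun x hx ↦ ?_)
        have h1 := hg x hx
        have h2 : ‖g x‖ ≤ ‖g x - multiplier m g x‖ + σ := by
          have := norm_add_le (g x - multiplier m g x) (multiplier m g x)
          rw [sub_add_cancel] at this
          linarith
        have h3 : ‖g x‖ ^ 2 ≤ 2 * ‖g x - multiplier m g x‖ ^ 2 + 2 * σ ^ 2 := by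
          nlinarith [sq_nonneg (‖g x - multiplier m g x‖ - σ), norm_nonneg (g x)]
        have h4 := ENNReal.ofReal_le_ofReal h3
        rw [ENNReal.ofReal_add (by positivity) (by positivity), ENNReal.ofReal_mul two_pos.le,
          ENNReal.ofReal_mul two_pos.le, ENNReal.ofReal_pow (norm_nonneg _),
          ENNReal.ofReal_pow (norm_nonneg _), ofReal_norm, ofReal_norm] at h4
        simpa using h4
    _ ≤ _ := by
        rw [lintegral_add_left (hsub.const_mul 2), lintegral_const_mul _ hsub, lintegral_const,
          Measure.restrict_apply_univ, mul_assoc]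
        gcongr
        exact (setLIntegral_le_lintegral _ _).trans
          (lintegral_enorm_sq_sub_multiplier_le hs hA hm hm1 g)

/-- Uniform decay at infinity makes the unit ball of test functions totally bounded in `L²`. -/
theorem totallyBounded_of_tail {s : ℝ} {V : Euc N → ℝ} (hs : 0 < s) (hV1 : CondV1 V)
    (hV : CondV2 s V) (htail : ∀ ε : ℝ, 0 < ε → ∃ R : ℝ, ∀ φ : TestSpace hs hV, ‖φ‖ ≤ 2 →
      ∫⁻ x in (Metric.closedBall (0 : Euc N) R)ᶜ, ‖(φ.val : Euc N → ℝ) x‖ₑ ^ 2 ≤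
        ENNReal.ofReal ε) :
    TotallyBounded (TestSpace.toL2 hs hV '' Metric.ball 0 1) := by
  obtain ⟨C, hC0, hC⟩ := hV.exists_bound hs hV1
  refine totallyBounded_image_of_forall_exists fun ε hε ↦ ?_
  -- Error budget: `ε²/8` for the tail and twice `ε²/16` each for the high frequencies and the net,
  -- in total `3ε²/8 < ε²`.
  obtain ⟨R, hR⟩ := htail (ε ^ 2 / 8) (by positivity)
  obtain ⟨A, hA1, hA⟩ : ∃ A : ℝ, A ^ (-(2 * s)) ≤ ε ^ 2 / 16 / (C * 2) ^ 2 ∧ 0 < A :=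
    (((tendsto_rpow_neg_atTop (by positivity : 0 < 2 * s)).eventually_le_const
      (by positivity)).and (eventually_gt_atTop 0)).exists
  obtain ⟨m, -, hm, hm1, -⟩ := exists_cutoff (N := N) hA
  obtain ⟨L, hL0, hL⟩ := exists_norm_multiplier_le m
  have hv : volume (Metric.closedBall (0 : Euc N) R) ≠ ⊤ := measure_closedBall_lt_top.ne
  set v := (volume (Metric.closedBall (0 : Euc N) R)).toReal with hvdef
  set σ : ℝ := Real.sqrt (ε ^ 2 / 16 / (v + 1)) with hσ
  have hv0 : 0 ≤ v := ENNReal.toReal_nonneg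
  have hσ0 : 0 < σ := Real.sqrt_pos.2 (by positivity)
  have hσ2 : σ ^ 2 = ε ^ 2 / 16 / (v + 1) := Real.sq_sqrt (by positivity)
  -- Mesh so fine that the Lipschitz bound `L * (C * 2)` for differences moves a value by at most `σ
  -- / 2` between a point and its net point.
  obtain ⟨t, htf, ht⟩ := Metric.totallyBounded_iff.1
    (isCompact_closedBall (0 : Euc N) R).totallyBounded (σ / 2 / (L * (C * 2) + 1)) (by positivity)
  have := htf.fintype
  -- The comparison map samples the low frequency part on the net: a bounded set in a
  -- finite-dimensional space.
  refine ⟨t → ℂ, inferInstance, fun φ x ↦ multiplier m (toSchwartz φ.val) x, σ / 2,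
    by positivity, ?_, fun φ hφ ψ hψ h ↦ ?_⟩
  · refine TotallyBounded.subset ?_ (isCompact_closedBall (0 : t → ℂ) (L * (C * 1))).totallyBounded
    rintro _ ⟨φ, hφ, rfl⟩
    rw [mem_ball_zero_iff] at hφ
    rw [mem_closedBall_zero_iff, pi_norm_le_iff_of_nonneg (by positivity)]
    intro x
    refine ((hL (toSchwartz φ.val) (C * ‖φ‖) (by positivity) ?_).1 x).trans (by gcongr)
    simpa only [enorm_toSchwartz] using (hC φ).2.2
  · rw [mem_ball_zero_iff] at hφ hψ
    have h1 : ‖φ - ψ‖ ≤ 2 := (norm_sub_le _ _).trans (by linarith)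
    set w := φ - ψ with hw
    have hwv : toSchwartz w.val = toSchwartz φ.val - toSchwartz ψ.val :=
      toSchwartz_sub φ.val ψ.val
    have hC2 : ENNReal.ofReal ((C * ‖w‖) ^ 2) ≤ ENNReal.ofReal ((C * 2) ^ 2) := by gcongr
    have hwL := (hL (toSchwartz w.val) (C * 2) (by positivity) (by
      simpa only [enorm_toSchwartz] using (hC w).2.2.trans hC2)).2
    have hball : ∀ x ∈ Metric.closedBall (0 : Euc N) R,
        ‖multiplier m (toSchwartz w.val) x‖ ≤ σ := by
      intro x hx
      obtain ⟨y, hy, hxy⟩ := Set.mem_iUnion₂.1 (ht hx)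
      have h2 : ‖multiplier m (toSchwartz w.val) y‖ ≤ σ / 2 := by
        have h3 := ((dist_pi_lt_iff (by positivity)).1 h ⟨y, hy⟩).le
        rwa [dist_eq_norm, ← sub_apply, ← multiplier_sub, ← hwv] at h3
      have h4 : L * ‖x - y‖ * (C * 2) ≤ σ / 2 := by
        rw [Metric.mem_ball, dist_eq_norm, lt_div_iff₀ (by positivity)] at hxy
        nlinarith [norm_nonneg (x - y)]
      have h5 := hwL x y
      have h6 := norm_sub_norm_le (multiplier m (toSchwartz w.val) x)
        (multiplier m (toSchwartz w.val) y)
      linarith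
    have hfin := lintegral_enorm_sq_le_of_net hs hA hm hm1 (toSchwartz w.val) hball
    simp only [enorm_toSchwartz] at hfin
    have hkin : ENNReal.ofReal (A ^ (-(2 * s))) * schwartzKinetic s (toSchwartz w.val) ≤
        ENNReal.ofReal (ε ^ 2 / 16) := by
      calc _ ≤ ENNReal.ofReal (ε ^ 2 / 16 / (C * 2) ^ 2) * ENNReal.ofReal ((C * 2) ^ 2) := by
            gcongr
            exact (hC w).1.trans hC2
        _ = _ := by
            rw [← ENNReal.ofReal_mul (by positivity), div_mul_cancel₀ _ (by positivity)]
    have hvol : ENNReal.ofReal (σ ^ 2) * volume (Metric.closedBall (0 : Euc N) R) ≤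
        ENNReal.ofReal (ε ^ 2 / 16) := by
      rw [← ENNReal.ofReal_toReal hv, ← hvdef, ← ENNReal.ofReal_mul (by positivity), hσ2]
      refine ENNReal.ofReal_le_ofReal ?_
      rw [div_mul_eq_mul_div, div_le_iff₀ (by positivity)]
      exact mul_le_mul_of_nonneg_left (by linarith) (by positivity)
    rw [lintegral_enorm_sq_test] at hfin
    have h7 : ENNReal.ofReal (‖testToL2 N w.val‖ ^ 2) ≤ ENNReal.ofReal (ε ^ 2 * (3 / 8)) := by
      refine hfin.trans ((add_le_add (add_le_add (mul_le_mul_right hkin 2)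
        (mul_le_mul_right hvol 2)) (hR w h1)).trans (le_of_eq ?_))
      rw [← ENNReal.ofReal_ofNat 2, ← ENNReal.ofReal_mul (by positivity),
        ← ENNReal.ofReal_add (by positivity) (by positivity),
        ← ENNReal.ofReal_add (by positivity) (by positivity)]
      congr 1; ring
    rw [ENNReal.ofReal_le_ofReal_iff (by positivity)] at h7
    rw [dist_eq_norm, ← map_sub, ← hw]
    change ‖testToL2 N w.val‖ < ε
    exact lt_of_pow_lt_pow_left₀ 2 hε.le (by linarith [sq_pos_of_pos hε])

/-! ### Uniform decay at infinity from `ν_θ` -/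

theorem enorm_sq_eq_ofReal (t : ℝ) : ‖t‖ₑ ^ 2 = ENNReal.ofReal (t ^ 2) := by
  rw [← ofReal_norm, ← ENNReal.ofReal_pow (norm_nonneg _), Real.norm_eq_abs, sq_abs]

/-- A lower bound of `ν_θ` gives an inequality for all test functions supported in `Ω`. -/
theorem mul_eLpNorm_sq_le_of_le_nu {s θ M : ℝ} (hs : 0 ≤ s) {V : Euc N → ℝ} {Ω : Set (Euc N)}
    (hM : (M : EReal) ≤ nu s V θ Ω) (ψ : testFunctions N)
    (hψ : ∀ x, x ∉ Ω → (ψ : Euc N → ℝ) x = 0) :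
    ENNReal.ofReal M * eLpNorm (ψ : Euc N → ℝ) (ENNReal.ofReal θ) volume ^ 2 ≤
      kinetic s (testToL2 N ψ) +
        ∫⁻ x, ENNReal.ofReal (max 0 (V x)) * ‖(ψ : Euc N → ℝ) x‖ₑ ^ 2 := by
  set n := eLpNorm (ψ : Euc N → ℝ) (ENNReal.ofReal θ) volume with hn
  have hnt : n ≠ ⊤ := (ψ.2.1.continuous.memLp_of_hasCompactSupport ψ.2.2).2.ne
  rcases eq_or_ne n 0 with h0 | h0
  · simp [h0]
  have hc : 0 < n.toReal := ENNReal.toReal_pos h0 hnt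
  set c : ℝ := n.toReal⁻¹ with hcdef
  have hc0 : 0 < c := inv_pos.2 hc
  have hcn : ENNReal.ofReal (c ^ 2) * n ^ 2 = 1 := by
    rw [← ENNReal.ofReal_toReal hnt, ← ENNReal.ofReal_pow hc.le, ← ENNReal.ofReal_mul
      (by positivity), hcdef, ← mul_pow, inv_mul_cancel₀ hc.ne']
    simp
  have hu := testToL2_coe (c • ψ)
  have hkin : kinetic s (testToL2 N (c • ψ)) = ENNReal.ofReal (c ^ 2) * kinetic s (testToL2 N ψ) := by
    have h1 : toSchwartz (c • ψ) = (c : ℂ) • toSchwartz ψ := by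
      ext x
      rw [smul_apply]
      exact Complex.ofReal_mul _ _
    rw [kinetic_test, kinetic_test, h1, schwartzKinetic_smul, ← ofReal_norm, Complex.norm_real,
      Real.norm_of_nonneg hc0.le, ENNReal.ofReal_pow hc0.le]
    ring
  have hadm : testToL2 N (c • ψ) ∈ admissible s θ Ω := by
    refine ⟨?_, ?_, ?_⟩
    · change kinetic s (testToL2 N (c • ψ)) < ⊤
      rw [kinetic_test]
      exact ENNReal.mul_lt_top ENNReal.ofReal_lt_top (schwartzKinetic_lt_top hs _)
    · filter_upwards [hu] with x hx hxΩ
      rw [hx]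
      change c * (ψ : Euc N → ℝ) x = 0
      rw [hψ x hxΩ, mul_zero]
    · rw [eLpNorm_congr_ae hu]
      change eLpNorm (c • (ψ : Euc N → ℝ)) _ _ = 1
      rw [eLpNorm_const_smul, ← hn, ← ofReal_norm, Real.norm_of_nonneg hc0.le, hcdef,
        ENNReal.ofReal_inv_of_pos hc, ENNReal.ofReal_toReal hnt, ENNReal.inv_mul_cancel h0 hnt]
  have h1 : (M : EReal) ≤ extendedEnergy s V (testToL2 N (c • ψ)) :=
    hM.trans (iInf₂_le _ hadm)
  -- The subtracted integral of the negative part is nonnegative and is dropped, so from here on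
  -- only `ℝ≥0∞` quantities occur.
  have h2 : extendedEnergy s V (testToL2 N (c • ψ)) ≤
      ((kinetic s (testToL2 N (c • ψ)) +
        ∫⁻ x, ENNReal.ofReal (V x * testToL2 N (c • ψ) x ^ 2) : ℝ≥0∞) : EReal) := by
    rw [extendedEnergy, EReal.coe_ennreal_add]
    refine add_le_add le_rfl ?_
    refine EReal.sub_le_of_le_add' ?_
    exact le_add_of_nonneg_left (EReal.coe_ennreal_nonneg _)
  have h3 : ENNReal.ofReal M ≤ kinetic s (testToL2 N (c • ψ)) +
        ∫⁻ x, ENNReal.ofReal (V x * testToL2 N (c • ψ) x ^ 2) := by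
    have := EReal.toENNReal_le_toENNReal (h1.trans h2)
    rwa [EReal.toENNReal_coe, EReal.toENNReal_of_ne_top (EReal.coe_ne_top _), EReal.toReal_coe] at this
  have h4 : ∫⁻ x, ENNReal.ofReal (V x * testToL2 N (c • ψ) x ^ 2) ≤ ENNReal.ofReal (c ^ 2) *
      ∫⁻ x, ENNReal.ofReal (max 0 (V x)) * ‖(ψ : Euc N → ℝ) x‖ₑ ^ 2 := by
    rw [← lintegral_const_mul' _ _ ENNReal.ofReal_ne_top]
    refine lintegral_mono_ae ?_
    filter_upwards [hu] with x hx
    rw [hx, enorm_sq_eq_ofReal, ← ENNReal.ofReal_mul (le_max_left _ _),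
      ← ENNReal.ofReal_mul (by positivity)]
    refine ENNReal.ofReal_le_ofReal ?_
    change V x * (c * (ψ : Euc N → ℝ) x) ^ 2 ≤ _
    calc _ = V x * (c ^ 2 * (ψ : Euc N → ℝ) x ^ 2) := by ring
      _ ≤ max 0 (V x) * (c ^ 2 * (ψ : Euc N → ℝ) x ^ 2) := by
        gcongr
        exact le_max_right _ _
      _ = _ := by ring
  calc _ ≤ (ENNReal.ofReal (c ^ 2) * kinetic s (testToL2 N ψ) + ENNReal.ofReal (c ^ 2) *
      ∫⁻ x, ENNReal.ofReal (max 0 (V x)) * ‖(ψ : Euc N → ℝ) x‖ₑ ^ 2) * n ^ 2 := by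
        gcongr
        rw [← hkin]
        exact h3.trans (by gcongr)
    _ = (ENNReal.ofReal (c ^ 2) * n ^ 2) * (kinetic s (testToL2 N ψ) +
      ∫⁻ x, ENNReal.ofReal (max 0 (V x)) * ‖(ψ : Euc N → ℝ) x‖ₑ ^ 2) := by ring
    _ = _ := by rw [hcn, one_mul]

/-- Hölder on a unit ball; translation invariance makes the constant independent of the centre. -/
theorem exists_lintegral_sq_le_eLpNorm_sq {θ : ℝ} (hθ : 2 ≤ θ) :
    ∃ K : ℝ≥0∞, K ≠ ⊤ ∧ ∀ (ψ : testFunctions N) (y : Euc N),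
      (∀ x, 1 < ‖x - y‖ → (ψ : Euc N → ℝ) x = 0) → ∫⁻ x, ‖(ψ : Euc N → ℝ) x‖ₑ ^ 2 ≤
        K * eLpNorm (ψ : Euc N → ℝ) (ENNReal.ofReal θ) volume ^ 2 := by
  have hr : 0 ≤ 1 / (2 : ℝ≥0∞).toReal - 1 / (ENNReal.ofReal θ).toReal := by
    rw [ENNReal.toReal_ofReal (by linarith), sub_nonneg]
    exact one_div_le_one_div_of_le (by simp) (by simpa using hθ)
  refine ⟨(volume (Metric.closedBall (0 : Euc N) 1) ^
    (1 / (2 : ℝ≥0∞).toReal - 1 / (ENNReal.ofReal θ).toReal)) ^ 2,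
    ENNReal.pow_ne_top (ENNReal.rpow_ne_top_of_nonneg hr measure_closedBall_lt_top.ne),
    fun ψ y hψ ↦ ?_⟩
  have hsupp : Function.support (ψ : Euc N → ℝ) ⊆ Metric.closedBall y 1 := by
    intro x hx
    by_contra h
    refine hx (hψ x ?_)
    rwa [Metric.mem_closedBall, dist_eq_norm, not_le] at h
  have h1 := eLpNorm_le_eLpNorm_mul_rpow_measure_univ
    (μ := volume.restrict (Metric.closedBall y 1)) (f := (ψ : Euc N → ℝ))
    (p := 2) (q := ENNReal.ofReal θ) (by simpa using ENNReal.ofReal_le_ofReal hθ)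
    ψ.2.1.continuous.aestronglyMeasurable
  rw [eLpNorm_restrict_eq_of_support_subset hsupp, eLpNorm_restrict_eq_of_support_subset hsupp,
    Measure.restrict_apply_univ, Measure.addHaar_closedBall_center] at h1
  have h2 : ∫⁻ x, ‖(ψ : Euc N → ℝ) x‖ₑ ^ 2 = eLpNorm (ψ : Euc N → ℝ) 2 volume ^ 2 := by
    rw [eLpNorm_eq_lintegral_rpow_enorm_toReal two_ne_zero ENNReal.ofNat_ne_top,
      ← ENNReal.rpow_natCast, ← ENNReal.rpow_mul]
    norm_num
  rw [h2, ← mul_pow, mul_comm]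
  exact pow_le_pow_left' h1 2

/-- `x ↦ χ(x - y) φ(x)` for test functions. -/
def window (χ φ : testFunctions N) (y : Euc N) : testFunctions N :=
  ⟨fun x ↦ (χ : Euc N → ℝ) (x - y) * (φ : Euc N → ℝ) x,
    (χ.2.1.comp (contDiff_id.sub contDiff_const)).mul φ.2.1, φ.2.2.mul_left⟩

theorem window_apply (χ φ : testFunctions N) (y x : Euc N) :
    (window χ φ y : Euc N → ℝ) x = (χ : Euc N → ℝ) (x - y) * (φ : Euc N → ℝ) x := rfl

theorem toSchwartz_window (χ φ : testFunctions N) (y : Euc N) :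
    toSchwartz (window χ φ y) = localize (toSchwartz χ) (toSchwartz φ) y := by
  ext x
  exact Complex.ofReal_mul _ _

theorem exists_window : ∃ χ : testFunctions N, (∀ x, 1 < ‖x‖ → (χ : Euc N → ℝ) x = 0) ∧
    ∫⁻ x, ‖(χ : Euc N → ℝ) x‖ₑ ^ 2 ≠ 0 ∧ ∫⁻ x, ‖(χ : Euc N → ℝ) x‖ₑ ^ 2 ≠ ⊤ := by
  let f : ContDiffBump (0 : Euc N) := ⟨1 / 2, 1, by norm_num, by norm_num⟩
  refine ⟨⟨f, f.contDiff, f.hasCompactSupport⟩, fun x hx ↦ f.zero_of_le_dist (by simpa using hx.le),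
    ?_, ?_⟩
  · have hm : Measurable fun x : Euc N ↦ ‖f x‖ₑ ^ 2 :=
      f.continuous.enorm.measurable.pow_const 2
    intro h
    have h1 := (lintegral_eq_zero_iff hm).1 h
    have h2 : (f : Euc N → ℝ) =ᵐ[volume] fun _ ↦ 0 := by
      filter_upwards [h1] with x hx
      simpa using hx
    have h3 := (Continuous.ae_eq_iff_eq volume f.continuous continuous_const).1 h2
    have h4 : f 0 = 1 := f.one_of_mem_closedBall (by simp [f])
    rw [h3] at h4
    exact zero_ne_one h4
  · rw [lintegral_enorm_sq_test]
    exact ENNReal.ofReal_ne_top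

theorem lintegral_enorm_sq_window_mul (χ : testFunctions N) (x : Euc N) (t : ℝ≥0∞) :
    ∫⁻ y, ‖(χ : Euc N → ℝ) (x - y)‖ₑ ^ 2 * t = (∫⁻ z, ‖(χ : Euc N → ℝ) z‖ₑ ^ 2) * t := by
  have hm : Measurable fun y ↦ ‖(χ : Euc N → ℝ) (x - y)‖ₑ ^ 2 :=
    (χ.2.1.continuous.comp (continuous_const.sub continuous_id)).enorm.measurable.pow_const 2
  rw [lintegral_mul_const _ hm]
  congr 1
  exact lintegral_sub_left_eq_self (fun z ↦ ‖(χ : Euc N → ℝ) z‖ₑ ^ 2) x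

theorem measurable_enorm_sq_window (χ φ : testFunctions N) :
    Measurable fun p : Euc N × Euc N ↦
      ‖(χ : Euc N → ℝ) (p.1 - p.2)‖ₑ ^ 2 * ‖(φ : Euc N → ℝ) p.1‖ₑ ^ 2 :=
  ((χ.2.1.continuous.comp (continuous_fst.sub continuous_snd)).enorm.measurable.pow_const 2).mul
    ((φ.2.1.continuous.comp continuous_fst).enorm.measurable.pow_const 2)

/-- The `L²` mass far out is controlled by the windows centred far out. -/
theorem lintegral_compl_closedBall_le (χ φ : testFunctions N)
    (hχ : ∀ x, 1 < ‖x‖ → (χ : Euc N → ℝ) x = 0) (R : ℝ) :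
    (∫⁻ z, ‖(χ : Euc N → ℝ) z‖ₑ ^ 2) *
        ∫⁻ x in (Metric.closedBall (0 : Euc N) (R + 2))ᶜ, ‖(φ : Euc N → ℝ) x‖ₑ ^ 2 ≤
      ∫⁻ y in (Metric.closedBall (0 : Euc N) (R + 1))ᶜ,
        ∫⁻ x, ‖(window χ φ y : Euc N → ℝ) x‖ₑ ^ 2 := by
  have hφ : Measurable fun x ↦ ‖(φ : Euc N → ℝ) x‖ₑ ^ 2 :=
    φ.2.1.continuous.enorm.measurable.pow_const 2
  have hS : MeasurableSet (Metric.closedBall (0 : Euc N) (R + 1))ᶜ :=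
    Metric.isClosed_closedBall.measurableSet.compl
  have hT : MeasurableSet (Metric.closedBall (0 : Euc N) (R + 2))ᶜ :=
    Metric.isClosed_closedBall.measurableSet.compl
  rw [← lintegral_const_mul _ hφ]
  simp only [fun x ↦ (lintegral_enorm_sq_window_mul χ x (‖(φ : Euc N → ℝ) x‖ₑ ^ 2)).symm]
  calc _ ≤ ∫⁻ x in (Metric.closedBall (0 : Euc N) (R + 2))ᶜ,
        ∫⁻ y in (Metric.closedBall (0 : Euc N) (R + 1))ᶜ,
          ‖(χ : Euc N → ℝ) (x - y)‖ₑ ^ 2 * ‖(φ : Euc N → ℝ) x‖ₑ ^ 2 := by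
        refine setLIntegral_mono_ae' hT (ae_of_all _ fun x hx ↦ ?_)
        rw [← lintegral_indicator hS]
        refine lintegral_mono fun y ↦ ?_
        by_cases hy : y ∈ (Metric.closedBall (0 : Euc N) (R + 1))ᶜ
        · rw [Set.indicator_of_mem hy]
        · have h1 : 1 < ‖x - y‖ := by
            simp only [Set.mem_compl_iff, mem_closedBall_zero_iff, not_le, not_lt] at hx hy
            have := norm_sub_norm_le x y
            linarith
          simp [hχ _ h1]
    _ ≤ ∫⁻ x, ∫⁻ y in (Metric.closedBall (0 : Euc N) (R + 1))ᶜ,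
          ‖(χ : Euc N → ℝ) (x - y)‖ₑ ^ 2 * ‖(φ : Euc N → ℝ) x‖ₑ ^ 2 := setLIntegral_le_lintegral _ _
    _ = ∫⁻ y in (Metric.closedBall (0 : Euc N) (R + 1))ᶜ, ∫⁻ x,
          ‖(χ : Euc N → ℝ) (x - y)‖ₑ ^ 2 * ‖(φ : Euc N → ℝ) x‖ₑ ^ 2 :=
        lintegral_lintegral_swap (measurable_enorm_sq_window χ φ).aemeasurable
    _ = _ := by
        simp only [window_apply, enorm_mul, mul_pow]

/-- Tonelli: the integral of `‖χ(x - y)‖²` over `y` does not depend on `x`, so averaging over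
windows reproduces the local term exactly. -/
theorem lintegral_potential_window {W : Euc N → ℝ≥0∞} (hW : AEMeasurable W)
    (χ φ : testFunctions N) :
    ∫⁻ y, ∫⁻ x, W x * ‖(window χ φ y : Euc N → ℝ) x‖ₑ ^ 2 =
      (∫⁻ z, ‖(χ : Euc N → ℝ) z‖ₑ ^ 2) * ∫⁻ x, W x * ‖(φ : Euc N → ℝ) x‖ₑ ^ 2 := by
  have hφ : Measurable fun x ↦ ‖(φ : Euc N → ℝ) x‖ₑ ^ 2 :=
    φ.2.1.continuous.enorm.measurable.pow_const 2
  have hj : AEMeasurable (fun p : Euc N × Euc N ↦ W p.2 *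
      (‖(χ : Euc N → ℝ) (p.2 - p.1)‖ₑ ^ 2 * ‖(φ : Euc N → ℝ) p.2‖ₑ ^ 2))
      (volume.prod volume) :=
    hW.comp_snd.mul ((measurable_enorm_sq_window χ φ).comp measurable_swap).aemeasurable
  simp only [window_apply, enorm_mul, mul_pow]
  have hWφ : AEMeasurable fun x ↦ W x * ‖(φ : Euc N → ℝ) x‖ₑ ^ 2 := hW.mul hφ.aemeasurable
  rw [lintegral_lintegral_swap hj, ← lintegral_const_mul'' _ hWφ]
  refine lintegral_congr fun x ↦ ?_
  rw [← lintegral_enorm_sq_window_mul]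
  refine lintegral_congr fun y ↦ ?_
  ring

/-- Under `(V₃)` the `L²` mass of bounded sets of test functions decays uniformly at infinity. -/
theorem exists_tail {s : ℝ} {V : Euc N → ℝ} (hs : 0 < s) (hV1 : CondV1 V)
    (hV : CondV2 s V) (hV3 : CondV3 s V) (ε : ℝ) (hε : 0 < ε) :
    ∃ R : ℝ, ∀ φ : TestSpace hs hV, ‖φ‖ ≤ 2 →
      ∫⁻ x in (Metric.closedBall (0 : Euc N) R)ᶜ, ‖(φ.val : Euc N → ℝ) x‖ₑ ^ 2 ≤
        ENNReal.ofReal ε := by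
  obtain ⟨θ, hθ, -, hlim⟩ := hV3
  obtain ⟨C, hC0, hC⟩ := hV.exists_bound hs hV1
  obtain ⟨χ, hχ, hχ0, hχt⟩ := exists_window (N := N)
  obtain ⟨K, hK, hKle⟩ := exists_lintegral_sq_le_eLpNorm_sq (N := N) hθ
  set c := ∫⁻ x, ‖(χ : Euc N → ℝ) x‖ₑ ^ 2 with hc
  set P := ENNReal.ofReal ((2 * Real.pi) ^ (2 * s))
  set E := ENNReal.ofReal ((C * 2) ^ 2)
  -- Bounds the integral over all centres of the windowed energies when `‖φ‖ ≤ 2`; it does not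
  -- involve `R`.
  set D : ℝ≥0∞ := K * (P * (ENNReal.ofReal (2 ^ (2 * s)) *
    (c * E + schwartzKinetic s (toSchwartz χ) * E)) + c * E) with hD
  have hDt : D ≠ ⊤ := by
    have h1 := (schwartzKinetic_lt_top hs.le (toSchwartz χ)).ne
    refine ENNReal.mul_ne_top hK (ENNReal.add_ne_top.2 ⟨ENNReal.mul_ne_top ENNReal.ofReal_ne_top
      (ENNReal.mul_ne_top ENNReal.ofReal_ne_top (ENNReal.add_ne_top.2 ⟨?_, ?_⟩)), ?_⟩)
    · exact ENNReal.mul_ne_top hχt ENNReal.ofReal_ne_top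
    · exact ENNReal.mul_ne_top h1 ENNReal.ofReal_ne_top
    · exact ENNReal.mul_ne_top hχt ENNReal.ofReal_ne_top
  set ct := c.toReal with hct
  have hct0 : 0 < ct := ENNReal.toReal_pos hχ0 hχt
  -- The final estimate reads `M * ct * tail ≤ D`, and this `M` makes the tail at most `ε`.
  set M : ℝ := (D.toReal + 1) / (ε * ct) with hM
  have hM0 : 0 < M := by positivity
  obtain ⟨R, hR⟩ := (((EReal.tendsto_nhds_top_iff_real.1 hlim) M)).exists
  refine ⟨R + 2, fun φ hφ ↦ ?_⟩
  have hE : ENNReal.ofReal ((C * ‖φ‖) ^ 2) ≤ E := ENNReal.ofReal_le_ofReal (by gcongr)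
  have hW : AEMeasurable (fun x ↦ ENNReal.ofReal (max 0 (V x))) :=
    (aemeasurable_const.max hV.locBounded.aestronglyMeasurable.aemeasurable).ennreal_ofReal
  -- A window has radius `1`, so one centred beyond `R + 1` vanishes on the ball of radius `R` and
  -- the lower bound of `ν` applies. Such windows see all the mass beyond `R + 2`.
  have hpw : ∀ y ∈ (Metric.closedBall (0 : Euc N) (R + 1))ᶜ,
      ENNReal.ofReal M * ∫⁻ x, ‖(window χ φ.val y : Euc N → ℝ) x‖ₑ ^ 2 ≤
        K * (P * schwartzKinetic s (localize (toSchwartz χ) (toSchwartz φ.val) y) +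
          ∫⁻ x, ENNReal.ofReal (max 0 (V x)) * ‖(window χ φ.val y : Euc N → ℝ) x‖ₑ ^ 2) := by
    intro y hy
    have h1 := mul_eLpNorm_sq_le_of_le_nu hs.le hR.le (window χ φ.val y) (fun x hx ↦ ?_)
    · rw [kinetic_test, toSchwartz_window] at h1
      calc _ ≤ ENNReal.ofReal M * (K * eLpNorm (window χ φ.val y : Euc N → ℝ)
            (ENNReal.ofReal θ) volume ^ 2) := by
            gcongr
            refine hKle _ y fun x hx ↦ ?_
            rw [window_apply, hχ _ hx, zero_mul]
        _ = K * (ENNReal.ofReal M * eLpNorm (window χ φ.val y : Euc N → ℝ)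
            (ENNReal.ofReal θ) volume ^ 2) := by ring
        _ ≤ _ := mul_le_mul_right h1 _
    · have h2 : 1 < ‖x - y‖ := by
        simp only [Set.mem_compl_iff, mem_closedBall_zero_iff, not_le, not_lt] at hx hy
        have := norm_sub_norm_le y x
        rw [norm_sub_rev]
        linarith
      rw [window_apply, hχ _ h2, zero_mul]
  have hpot : ∫⁻ y, ∫⁻ x, ENNReal.ofReal (max 0 (V x)) *
      ‖(window χ φ.val y : Euc N → ℝ) x‖ₑ ^ 2 ≤ c * E := by
    rw [lintegral_potential_window hW]
    exact mul_le_mul_right ((hC φ).2.1.trans hE) _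
  have hkin : ∫⁻ y, schwartzKinetic s (localize (toSchwartz χ) (toSchwartz φ.val) y) ≤
      ENNReal.ofReal (2 ^ (2 * s)) * (c * E + schwartzKinetic s (toSchwartz χ) * E) := by
    refine (lintegral_schwartzKinetic_localize_le hs.le _ _).trans ?_
    simp only [enorm_toSchwartz]
    gcongr
    · exact (hC φ).1.trans hE
    · exact (hC φ).2.2.trans hE
  have hpm : AEMeasurable (fun y ↦ ∫⁻ x, ENNReal.ofReal (max 0 (V x)) *
      ‖(window χ φ.val y : Euc N → ℝ) x‖ₑ ^ 2) := by
    have hj : AEMeasurable (fun p : Euc N × Euc N ↦ ENNReal.ofReal (max 0 (V p.2)) *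
        ‖(window χ φ.val p.1 : Euc N → ℝ) p.2‖ₑ ^ 2) (volume.prod volume) := by
      simp only [window_apply, enorm_mul, mul_pow]
      exact hW.comp_snd.mul
        ((measurable_enorm_sq_window χ φ.val).comp measurable_swap).aemeasurable
    exact hj.lintegral_prod_right'
  have hmain : ENNReal.ofReal M * (c *
      ∫⁻ x in (Metric.closedBall (0 : Euc N) (R + 2))ᶜ, ‖(φ.val : Euc N → ℝ) x‖ₑ ^ 2) ≤ D :=
    calc _ ≤ ENNReal.ofReal M * ∫⁻ y in (Metric.closedBall (0 : Euc N) (R + 1))ᶜ,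
          ∫⁻ x, ‖(window χ φ.val y : Euc N → ℝ) x‖ₑ ^ 2 :=
          mul_le_mul_right (lintegral_compl_closedBall_le χ φ.val hχ R) _
      _ = ∫⁻ y in (Metric.closedBall (0 : Euc N) (R + 1))ᶜ,
          ENNReal.ofReal M * ∫⁻ x, ‖(window χ φ.val y : Euc N → ℝ) x‖ₑ ^ 2 :=
          (lintegral_const_mul' _ _ ENNReal.ofReal_ne_top).symm
      _ ≤ ∫⁻ y in (Metric.closedBall (0 : Euc N) (R + 1))ᶜ, K * (P * schwartzKinetic s
            (localize (toSchwartz χ) (toSchwartz φ.val) y) + ∫⁻ x, ENNReal.ofReal (max 0 (V x)) *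
              ‖(window χ φ.val y : Euc N → ℝ) x‖ₑ ^ 2) :=
          setLIntegral_mono_ae' Metric.isClosed_closedBall.measurableSet.compl
            (ae_of_all _ hpw)
      _ ≤ ∫⁻ y, K * (P * schwartzKinetic s
            (localize (toSchwartz χ) (toSchwartz φ.val) y) + ∫⁻ x, ENNReal.ofReal (max 0 (V x)) *
              ‖(window χ φ.val y : Euc N → ℝ) x‖ₑ ^ 2) := setLIntegral_le_lintegral _ _
      _ ≤ D := by
          rw [lintegral_const_mul' _ _ hK, lintegral_add_right' _ hpm,
            lintegral_const_mul' _ _ ENNReal.ofReal_ne_top, hD]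
          gcongr
  rw [← ENNReal.ofReal_toReal hχt, ← hct, ← mul_assoc, ← ENNReal.ofReal_mul hM0.le, mul_comm,
    ← ENNReal.le_div_iff_mul_le (Or.inl (by simp; positivity)) (Or.inl ENNReal.ofReal_ne_top),
    ← ENNReal.ofReal_toReal hDt, ← ENNReal.ofReal_div_of_pos (by positivity)] at hmain
  refine hmain.trans (ENNReal.ofReal_le_ofReal ?_)
  have h1 : M * ct = (D.toReal + 1) / ε := by rw [hM]; field_simp
  have h2 : 0 ≤ D.toReal := ENNReal.toReal_nonneg
  rw [h1, div_div_eq_mul_div, div_le_iff₀ (by positivity)]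
  nlinarith

/-! ### Interpolation against the `L²` norm and the weighted embeddings -/

section Controlled

variable {s : ℝ} {V : Euc N → ℝ} (hs : 0 < s) (hV : CondV2 s V)

/-- On bounded sets of test functions, smallness in `L²` forces smallness in `L^θ(μ)`. -/
def Controlled (μ : Measure (Euc N)) (θ : ℝ) : Prop :=
  ∃ ω : ℝ≥0∞ → ℝ≥0∞, Continuous ω ∧ ω 0 = 0 ∧ ∀ φ : TestSpace hs hV, ‖φ‖ ≤ 2 →
    ∫⁻ x, ‖(φ.val : Euc N → ℝ) x‖ₑ ^ θ ∂μ ≤ ω (ENNReal.ofReal ‖testToL2 N φ.val‖)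

variable {hs hV}

theorem Controlled.exists_small {μ : Measure (Euc N)} {θ : ℝ} (hθ : 1 ≤ θ)
    (h : Controlled hs hV μ θ) (ε : ℝ) (hε : 0 < ε) : ∃ δ : ℝ, 0 < δ ∧
      ∀ φ : TestSpace hs hV, ‖φ‖ ≤ 2 → ‖testToL2 N φ.val‖ ≤ δ →
        eLpNorm (φ.val : Euc N → ℝ) (ENNReal.ofReal θ) μ ≤ ENNReal.ofReal ε := by
  obtain ⟨ω, hω, hω0, hle⟩ := h
  have hcont : Tendsto (fun t : ℝ ↦ ω (ENNReal.ofReal t)) (𝓝 0) (𝓝 0) := by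
    have := (hω.comp ENNReal.continuous_ofReal).tendsto 0
    simpa [Function.comp_def, hω0] using this
  have hev := hcont.eventually_lt_const
    (ENNReal.ofReal_pos.2 (Real.rpow_pos_of_pos hε θ))
  obtain ⟨δ, hδ, hδω⟩ := Metric.eventually_nhds_iff.1 hev
  refine ⟨δ / 2, by positivity, fun φ hφ hφδ ↦ ?_⟩
  have h1 := (hle φ hφ).trans (hδω (y := ‖testToL2 N φ.val‖) (by
    rw [dist_zero_right, norm_norm]; linarith)).le
  have hθ0 : 0 < θ := by linarith
  rw [eLpNorm_eq_lintegral_rpow_enorm_toReal (by simpa using hθ0) ENNReal.ofReal_ne_top,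
    ENNReal.toReal_ofReal hθ0.le]
  calc _ ≤ ENNReal.ofReal (ε ^ θ) ^ (1 / θ) := by gcongr
    _ = _ := by
      rw [ENNReal.ofReal_rpow_of_nonneg (by positivity) (by positivity), ← Real.rpow_mul hε.le,
        mul_one_div_cancel hθ0.ne', Real.rpow_one]

/-- Homogeneity: `L²` smallness is forced by a small energy norm, so smallness at one scale extends
linearly. -/
theorem Controlled.exists_bound {μ : Measure (Euc N)} {θ : ℝ} (hθ : 1 ≤ θ)
    (h : Controlled hs hV μ θ) : ∃ C : ℝ, ∀ φ : TestSpace hs hV,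
      eLpNorm (φ.val : Euc N → ℝ) (ENNReal.ofReal θ) μ ≤ ENNReal.ofReal (C * ‖φ‖) := by
  obtain ⟨δ, hδ, hle⟩ := h.exists_small hθ 1 one_pos
  set c := ‖TestSpace.toL2 hs hV‖ with hc
  have hc0 : 0 ≤ c := ContinuousLinearMap.opNorm_nonneg _
  -- On the sphere of radius `r` both requirements hold: the norm is at most `2`, and the `L²` norm
  -- is at most `c * r ≤ δ`.
  set r := min 2 (δ / (c + 1)) with hr
  have hr0 : 0 < r := lt_min two_pos (by positivity)
  refine ⟨r⁻¹, fun φ ↦ ?_⟩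
  rcases eq_or_ne φ 0 with rfl | hφ
  · have h0 : (TestSpace.val hs hV 0 : Euc N → ℝ) = 0 := rfl
    simp [h0]
  have hn : 0 < ‖φ‖ := norm_pos_iff.2 hφ
  have hψ : ‖(r / ‖φ‖) • φ‖ = r := by
    rw [norm_smul, Real.norm_of_nonneg (by positivity), div_mul_cancel₀ _ hn.ne']
  have h1 := hle ((r / ‖φ‖) • φ) (hψ.le.trans (min_le_left _ _)) (by
    change ‖TestSpace.toL2 hs hV ((r / ‖φ‖) • φ)‖ ≤ δ
    refine (ContinuousLinearMap.le_opNorm _ _).trans ?_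
    rw [hψ, ← hc]
    have h2 : r ≤ δ / (c + 1) := min_le_right _ _
    rw [le_div_iff₀ (by positivity)] at h2
    nlinarith)
  change eLpNorm ((r / ‖φ‖) • (φ.val : Euc N → ℝ)) _ _ ≤ _ at h1
  rw [eLpNorm_const_smul, ← ofReal_norm, Real.norm_of_nonneg (by positivity)] at h1
  have h3 : ENNReal.ofReal (r⁻¹ * ‖φ‖) * ENNReal.ofReal (r / ‖φ‖) = 1 := by
    rw [← ENNReal.ofReal_mul (by positivity)]
    have : r⁻¹ * ‖φ‖ * (r / ‖φ‖) = 1 := by field_simp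
    rw [this, ENNReal.ofReal_one]
  calc _ = ENNReal.ofReal (r⁻¹ * ‖φ‖) * (ENNReal.ofReal (r / ‖φ‖) *
        eLpNorm (φ.val : Euc N → ℝ) (ENNReal.ofReal θ) μ) := by rw [← mul_assoc, h3, one_mul]
    _ ≤ ENNReal.ofReal (r⁻¹ * ‖φ‖) * ENNReal.ofReal 1 := by gcongr
    _ = _ := by rw [ENNReal.ofReal_one, mul_one]

theorem Controlled.embedsContinuously {μ : Measure (Euc N)} (hμ : μ ≪ volume) {θ : ℝ} (hθ : 1 ≤ θ)
    (h : Controlled hs hV μ θ) : EmbedsContinuously hs hV μ θ := by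
  obtain ⟨C, hC⟩ := h.exists_bound hθ
  exact embedsContinuously_of_bound hs hV hμ hθ hC

theorem Controlled.embedsCompactly {μ : Measure (Euc N)} (hμ : μ ≪ volume) {θ : ℝ} (hθ : 1 ≤ θ)
    (htb : TotallyBounded (TestSpace.toL2 hs hV '' Metric.ball 0 1))
    (h : Controlled hs hV μ θ) : EmbedsCompactly hs hV μ θ := by
  obtain ⟨C, hC⟩ := h.exists_bound hθ
  exact embedsCompactly_of_bound hs hV hμ hθ hC htb (h.exists_small hθ)

theorem lintegral_weighted {K : Euc N → ℝ} (hK : AEMeasurable K) (φ : testFunctions N) (θ : ℝ) :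
    ∫⁻ x, ‖(φ : Euc N → ℝ) x‖ₑ ^ θ ∂(weighted K) =
      ∫⁻ x, ENNReal.ofReal (K x) * ‖(φ : Euc N → ℝ) x‖ₑ ^ θ :=
  lintegral_withDensity_eq_lintegral_mul₀ hK.ennreal_ofReal
    (φ.2.1.continuous.enorm.measurable.pow_const θ).aemeasurable

theorem weighted_absolutelyContinuous (K : Euc N → ℝ) : weighted K ≪ volume :=
  withDensity_absolutelyContinuous _ _

/-- Interpolation `θ = t r + 2 (1 - t)` with `θ < r < 2*_s`. The strict inequality `θ < r` leaves a
positive power of the `L²` norm, hence a modulus vanishing at `0`. -/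
theorem controlled_volume (hV1 : CondV1 V) (hsN : s < (N : ℝ) / 2) {θ : ℝ} (hθ : 2 ≤ θ)
    (hθ' : θ < critExp N s) : Controlled hs hV volume θ := by
  obtain ⟨C, hC0, hC⟩ := hV.exists_bound hs hV1
  obtain ⟨r, hr, hr'⟩ := exists_between hθ'
  obtain ⟨K, hK, hKle⟩ := exists_lintegral_rpow_le hs hsN (hθ.trans hr.le) hr'
  set t := (θ - 2) / (r - 2) with ht
  have hr2 : 0 < r - 2 := by linarith
  have ht0 : 0 ≤ t := div_nonneg (by linarith) hr2.le
  have ht1 : t < 1 := by rw [ht, div_lt_one hr2]; linarith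
  have hKt : (K * ENNReal.ofReal ((C * 2) ^ r)) ^ t ≠ ⊤ :=
    ENNReal.rpow_ne_top_of_nonneg ht0 (ENNReal.mul_ne_top hK ENNReal.ofReal_ne_top)
  refine ⟨fun z ↦ (K * ENNReal.ofReal ((C * 2) ^ r)) ^ t * (z ^ 2) ^ (1 - t), ?_, ?_,
    fun φ hφ ↦ ?_⟩
  · exact (ENNReal.continuous_const_mul hKt).comp
      (ENNReal.continuous_rpow_const.comp (ENNReal.continuous_pow 2))
  · have : 0 < 1 - t := by linarith
    simp [ENNReal.zero_rpow_of_pos this]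
  · have hE : ENNReal.ofReal ((C * ‖φ‖) ^ 2) ≤ ENNReal.ofReal ((C * 2) ^ 2) :=
      ENNReal.ofReal_le_ofReal (by gcongr)
    have h1 := hKle (toSchwartz φ.val) (C * 2) (by positivity) ((hC φ).1.trans hE) (by
      simpa only [enorm_toSchwartz] using (hC φ).2.2.trans hE)
    simp only [enorm_toSchwartz] at h1
    have hm : ∀ p : ℝ, AEMeasurable (fun x ↦ ‖(φ.val : Euc N → ℝ) x‖ₑ ^ p) volume :=
      fun p ↦ (φ.val.2.1.continuous.enorm.measurable.pow_const p).aemeasurable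
    have h2 := ENNReal.lintegral_mul_norm_pow_le (hm r) (hm 2) ht0 (by linarith : 0 ≤ 1 - t)
      (by ring)
    calc ∫⁻ x, ‖(φ.val : Euc N → ℝ) x‖ₑ ^ θ
        = ∫⁻ x, (‖(φ.val : Euc N → ℝ) x‖ₑ ^ r) ^ t *
            (‖(φ.val : Euc N → ℝ) x‖ₑ ^ (2 : ℝ)) ^ (1 - t) := by
          refine lintegral_congr fun x ↦ ?_
          rw [← ENNReal.rpow_mul, ← ENNReal.rpow_mul, ← ENNReal.rpow_add_of_nonneg _ _
            (by nlinarith) (by nlinarith)]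
          congr 1
          rw [ht]; field_simp; ring
      _ ≤ _ := h2
      _ ≤ _ := by
          simp only [ENNReal.rpow_two]
          rw [lintegral_enorm_sq_test, ← ENNReal.ofReal_pow (norm_nonneg _)]
          gcongr

/-- The growth condition with `α = 1 / t` outside a ball, local boundedness inside. Every `t` in
`(0, 1)` is available because `α > 1` is arbitrary. -/
theorem CondB1.exists_le {V b : Euc N → ℝ} (hb : CondB1 V b) {t : ℝ} (ht0 : 0 < t) (ht1 : t < 1) :
    ∃ C : ℝ≥0∞, C ≠ ⊤ ∧ ∀ᵐ x, ENNReal.ofReal (b x) ≤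
      C * (1 + ENNReal.ofReal (max 0 (V x)) ^ t) := by
  obtain ⟨C₀, R₀, hC₀, -, h⟩ := hb.growth (1 / t) ((one_lt_div ht0).2 ht1)
  have hloc := hb.locBounded _ (isCompact_closedBall (0 : Euc N) R₀)
  set M := eLpNorm b ⊤ (volume.restrict (Metric.closedBall (0 : Euc N) R₀)) with hM
  have hMt : M ≠ ⊤ := hloc.2.ne
  have hin : ∀ᵐ x, x ∈ Metric.closedBall (0 : Euc N) R₀ → ‖b x‖ₑ ≤ M := by
    rw [← ae_restrict_iff' Metric.isClosed_closedBall.measurableSet, hM, eLpNorm_exponent_top]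
    exact enorm_ae_le_eLpNormEssSup _ _
  refine ⟨ENNReal.ofReal C₀ + M, ENNReal.add_ne_top.2 ⟨ENNReal.ofReal_ne_top, hMt⟩, ?_⟩
  filter_upwards [h, hin] with x hx hx'
  rcases le_total R₀ ‖x‖ with hR | hR
  · have h1 := ENNReal.ofReal_le_ofReal (hx hR)
    rw [ENNReal.ofReal_mul hC₀.le, ENNReal.ofReal_add zero_le_one (by positivity), one_div_one_div,
      ← ENNReal.ofReal_rpow_of_nonneg (le_max_left _ _) ht0.le, ENNReal.ofReal_one] at h1
    refine h1.trans ?_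
    gcongr
    exact le_self_add
  · calc ENNReal.ofReal (b x) ≤ ‖b x‖ₑ := Real.ofReal_le_enorm _
      _ ≤ M * 1 := by rw [mul_one]; exact hx' (by simpa using hR)
      _ ≤ _ := mul_le_mul' le_add_self le_self_add

/-- Write `(V⁺)^t |u|^θ = (V⁺ u²)^t (|u|^r)^(1-t)`. The energy bounds the first factor, and a
subcritical `r` makes the second small through `controlled_volume`. -/
theorem controlled_weighted (hV1 : CondV1 V) (hsN : s < (N : ℝ) / 2) {b : Euc N → ℝ}
    (hb : CondB1 V b) {θ : ℝ} (hθ : 2 ≤ θ) (hθ' : θ < critExp N s) :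
    Controlled hs hV (weighted b) θ := by
  obtain ⟨C, hC0, hC⟩ := hV.exists_bound hs hV1
  -- Half of the threshold below which `r = (θ - 2t) / (1 - t)` remains subcritical; `r ≥ 2` follows
  -- from `θ ≥ 2`.
  set t := (critExp N s - θ) / (2 * (critExp N s - 2)) with ht
  have hc2 : 0 < critExp N s - 2 := by linarith
  have ht0 : 0 < t := div_pos (by linarith) (by linarith)
  have htc : t * (critExp N s - 2) = (critExp N s - θ) / 2 := by rw [ht]; field_simp
  have ht1 : t < 1 := by rw [ht, div_lt_one (by linarith)]; linarith
  have h1t : 0 < 1 - t := by linarith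
  set r := (θ - 2 * t) / (1 - t) with hr
  have hr2 : 2 ≤ r := by rw [hr, le_div_iff₀ h1t]; linarith
  have hrc : r < critExp N s := by rw [hr, div_lt_iff₀ h1t]; linarith
  have hrt : r * (1 - t) = θ - 2 * t := by rw [hr]; field_simp
  obtain ⟨B, hB, hBle⟩ := hb.exists_le ht0 ht1
  obtain ⟨ω₁, hω₁, hω₁0, h₁⟩ := controlled_volume (hs := hs) (hV := hV) hV1 hsN hθ hθ'
  obtain ⟨ω₂, hω₂, hω₂0, h₂⟩ := controlled_volume (hs := hs) (hV := hV) hV1 hsN hr2 hrc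
  have hEt : ENNReal.ofReal ((C * 2) ^ 2) ^ t ≠ ⊤ :=
    ENNReal.rpow_ne_top_of_nonneg ht0.le ENNReal.ofReal_ne_top
  refine ⟨fun z ↦ B * (ω₁ z + ENNReal.ofReal ((C * 2) ^ 2) ^ t * ω₂ z ^ (1 - t)), ?_, ?_,
    fun φ hφ ↦ ?_⟩
  · exact (ENNReal.continuous_const_mul hB).comp (hω₁.add ((ENNReal.continuous_const_mul hEt).comp
      (ENNReal.continuous_rpow_const.comp hω₂)))
  · simp [hω₁0, hω₂0, ENNReal.zero_rpow_of_pos h1t]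
  · have hE : ENNReal.ofReal ((C * ‖φ‖) ^ 2) ≤ ENNReal.ofReal ((C * 2) ^ 2) :=
      ENNReal.ofReal_le_ofReal (by gcongr)
    have hm : ∀ p : ℝ, Measurable (fun x ↦ ‖(φ.val : Euc N → ℝ) x‖ₑ ^ p) :=
      fun p ↦ φ.val.2.1.continuous.enorm.measurable.pow_const p
    have hW : AEMeasurable (fun x ↦ ENNReal.ofReal (max 0 (V x))) :=
      (aemeasurable_const.max hV.locBounded.aestronglyMeasurable.aemeasurable).ennreal_ofReal
    have h3 := ENNReal.lintegral_mul_norm_pow_le (μ := volume)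
      (f := fun x ↦ ENNReal.ofReal (max 0 (V x)) * ‖(φ.val : Euc N → ℝ) x‖ₑ ^ (2 : ℝ))
      (hW.mul (hm 2).aemeasurable) (hm r).aemeasurable ht0.le h1t.le (by ring)
    simp only [ENNReal.rpow_two] at h3
    rw [lintegral_weighted hb.locBounded.aestronglyMeasurable.aemeasurable]
    calc ∫⁻ x, ENNReal.ofReal (b x) * ‖(φ.val : Euc N → ℝ) x‖ₑ ^ θ
        ≤ ∫⁻ x, B * (‖(φ.val : Euc N → ℝ) x‖ₑ ^ θ +
            (ENNReal.ofReal (max 0 (V x)) * ‖(φ.val : Euc N → ℝ) x‖ₑ ^ 2) ^ t *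
              (‖(φ.val : Euc N → ℝ) x‖ₑ ^ r) ^ (1 - t)) := by
          refine lintegral_mono_ae ?_
          filter_upwards [hBle] with x hx
          refine (mul_le_mul_left hx _).trans (le_of_eq ?_)
          have h4 : ‖(φ.val : Euc N → ℝ) x‖ₑ ^ θ =
              (‖(φ.val : Euc N → ℝ) x‖ₑ ^ 2) ^ t * (‖(φ.val : Euc N → ℝ) x‖ₑ ^ r) ^ (1 - t) := by
            rw [← ENNReal.rpow_two, ← ENNReal.rpow_mul, ← ENNReal.rpow_mul, hrt,
              ← ENNReal.rpow_add_of_nonneg _ _ (by positivity) (by linarith)]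
            congr 1; ring
          rw [ENNReal.mul_rpow_of_nonneg _ _ ht0.le, mul_assoc _ _ ((_ : ℝ≥0∞) ^ (1 - t)), ← h4]
          ring
      _ = B * ((∫⁻ x, ‖(φ.val : Euc N → ℝ) x‖ₑ ^ θ) +
          ∫⁻ x, (ENNReal.ofReal (max 0 (V x)) * ‖(φ.val : Euc N → ℝ) x‖ₑ ^ 2) ^ t *
              (‖(φ.val : Euc N → ℝ) x‖ₑ ^ r) ^ (1 - t)) := by
          rw [lintegral_const_mul' _ _ hB, lintegral_add_left (hm θ)]
      _ ≤ _ := by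
          beta_reduce
          gcongr
          · exact h₁ φ hφ
          · refine h3.trans ?_
            gcongr
            · exact (hC φ).2.1.trans hE
            · exact h₂ φ hφ

/-- Hölder with the conjugate exponents `p / (p - q)` and `p / q`, then `controlled_volume` at the
subcritical exponent `p`. -/
theorem controlled_weighted_of_condA1 (hV1 : CondV1 V) (hsN : s < (N : ℝ) / 2) {p q : ℝ}
    (hp : 2 < p) (hp' : p < critExp N s) (hq : 1 < q) (hq' : q < 2) {a : Euc N → ℝ}
    (ha : CondA1 p q a) : Controlled hs hV (weighted a) q := by
  obtain ⟨ω, hω, hω0, h⟩ := controlled_volume (hs := hs) (hV := hV) hV1 hsN hp.le hp'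
  have hpq : 0 < p - q := by linarith
  have hp0 : 0 < p := by linarith
  set A := ∫⁻ x, ‖a x‖ₑ ^ (p / (p - q)) with hA
  have hAt : A ≠ ⊤ := by
    have h1 := lintegral_rpow_enorm_lt_top_of_eLpNorm_lt_top
      (by simpa using div_pos hp0 hpq) ENNReal.ofReal_ne_top ha.memLp.2
    rw [ENNReal.toReal_ofReal (by positivity)] at h1
    exact h1.ne
  have hAr : A ^ ((p - q) / p) ≠ ⊤ := ENNReal.rpow_ne_top_of_nonneg (by positivity) hAt
  have hqp : 0 < q / p := by positivity
  refine ⟨fun z ↦ A ^ ((p - q) / p) * ω z ^ (q / p), ?_, ?_, fun φ hφ ↦ ?_⟩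
  · exact (ENNReal.continuous_const_mul hAr).comp (ENNReal.continuous_rpow_const.comp hω)
  · simp [hω0, ENNReal.zero_rpow_of_pos hqp]
  · have hm : AEMeasurable (fun x ↦ ‖(φ.val : Euc N → ℝ) x‖ₑ ^ p) :=
      (φ.val.2.1.continuous.enorm.measurable.pow_const p).aemeasurable
    have h3 := ENNReal.lintegral_mul_norm_pow_le
      (ha.memLp.1.enorm.pow_const (p / (p - q))) hm
      (by positivity : 0 ≤ (p - q) / p) hqp.le (by field_simp; ring)
    rw [lintegral_weighted ha.memLp.1.aemeasurable]
    calc ∫⁻ x, ENNReal.ofReal (a x) * ‖(φ.val : Euc N → ℝ) x‖ₑ ^ q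
        ≤ ∫⁻ x, (‖a x‖ₑ ^ (p / (p - q))) ^ ((p - q) / p) *
            (‖(φ.val : Euc N → ℝ) x‖ₑ ^ p) ^ (q / p) := by
          refine lintegral_mono fun x ↦ ?_
          rw [← ENNReal.rpow_mul, ← ENNReal.rpow_mul,
            show p / (p - q) * ((p - q) / p) = 1 by field_simp, mul_div_cancel₀ _ hp0.ne',
            ENNReal.rpow_one]
          gcongr
          exact Real.ofReal_le_enorm _
      _ ≤ _ := h3
      _ ≤ _ := by
          beta_reduce
          gcongr
          exact h φ hφ

end Controlled

end FracSobolev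

end

theorem mainTheorem4 (N : ℕ) (s : ℝ) (hs : 0 < s) (hs1 : s < 1) (hsN : s < (N : ℝ) / 2)
    (V b : FracSobolev.Euc N → ℝ)
    (hV1 : FracSobolev.CondV1 V) (hV2 : FracSobolev.CondV2 s V)
    (hb : FracSobolev.CondB1 V b) :
    Function.Injective (FracSobolev.HsV.toL2 hs hV2) ∧
    (∀ θ : ℝ, 2 ≤ θ → θ < FracSobolev.critExp N s →
      FracSobolev.EmbedsContinuously hs hV2 (FracSobolev.weighted b) θ) ∧
    (FracSobolev.CondV3 s V →
      (∀ θ : ℝ, 2 ≤ θ → θ < FracSobolev.critExp N s →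
        FracSobolev.EmbedsCompactly hs hV2 (FracSobolev.weighted b) θ ∧
        FracSobolev.EmbedsCompactly hs hV2 volume θ) ∧
      (∀ p q : ℝ, 2 < p → p < FracSobolev.critExp N s → 1 < q → q < 2 →
        ∀ a : FracSobolev.Euc N → ℝ, FracSobolev.CondA1 p q a →
          FracSobolev.EmbedsCompactly hs hV2 (FracSobolev.weighted a) q)) := by
  refine ⟨FracSobolev.HsV.toL2_injective hs hV2, fun θ hθ hθ' ↦ ?_, fun hV3 ↦ ?_⟩
  · exact (FracSobolev.controlled_weighted hV1 hsN hb hθ hθ').embedsContinuously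
      (FracSobolev.weighted_absolutelyContinuous b) (by linarith)
  · have htb := FracSobolev.totallyBounded_of_tail hs hV1 hV2
      (FracSobolev.exists_tail hs hV1 hV2 hV3)
    refine ⟨fun θ hθ hθ' ↦ ⟨?_, ?_⟩, fun p q hp hp' hq hq' a ha ↦ ?_⟩
    · exact (FracSobolev.controlled_weighted hV1 hsN hb hθ hθ').embedsCompactly
        (FracSobolev.weighted_absolutelyContinuous b) (by linarith) htb
    · exact (FracSobolev.controlled_volume hV1 hsN hθ hθ').embedsCompactly
        (Measure.AbsolutelyContinuous.refl _) (by linarith) htb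
    · exact (FracSobolev.controlled_weighted_of_condA1 hV1 hsN hp hp' hq hq' ha).embedsCompactly
        (FracSobolev.weighted_absolutelyContinuous a) hq.le htb
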